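/- **Proposition 3.1.** Let $n\ge 2$ and let $\Omega\subset\mathbb R^n$ be open. For $x\in\mathbb R^n$ and $R>0$ let $Q_R(x)=\{y\in\mathbb R^n:\max_{1\le i\le n}|y_i-x_i|<R\}$; write $\|\cdot\|_{q,A}$ for the norm of $L^q(A)$ with respect to Lebesgue measure, $\mathrm{dist}$ for the Euclidean distance (with $\mathrm{dist}(z,\emptyset)=\infty$), and $A\subset\subset U$ if $\overline A$ is compact and contained in $U$. Let $p>1$, $\delta>0$, and let $\Phi\in L^p(\Omega)$ and $\Psi\in L^{p+\delta}(\Omega)$ be nonnegative a.e. in $\Omega$. Suppose that for some constants $\alpha\in[1/2,1)$, $R_0>0$ and $B>0$, $$\frac1{R^n}\int_{Q_{\alpha R}(z)}\Phi^p\,dx\le B\Big(\frac1{R^n}\int_{Q_R(z)}\Phi\,dx\Big)^p+\frac1{R^n}\int_{Q_R(z)}\Psi^p\,dx$$ for all $z\in\Omega$ and all $0<R<\min\{\mathrm{dist}(z,\partial\Omega)/\sqrt n,\,R_0\}$. Put $$\varkappa=(8^n+1)\,2^{3np}\,(B^{1/p}+1)^p .$$ Then, for every real $q$ with $p\le q\le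 p+\delta$ and $q<p+(p-1)/(\varkappa-1)$: 1. $\Phi\in L^q_{\rm loc}(\Omega)$, that is, $\Phi\in L^q(K)$ for every compact $K\subset\Omega$. 2. For every cube $Q_r(x_0)\subset\subset\Omega$ with $0<r<R_0$ and every measurable set $\omega\subset\subset Q_r(x_0)$, $$\|\Phi\|_{q,\omega}^q\le\big[\mathrm{dist}(\omega,\partial Q_r(x_0))\big]^{-nq/p}\Big[\frac{\varkappa(q-1)\,r^{nq/p}}{q-1-\varkappa(q-p)}\,\|\Psi\|_{q,Q_r(x_0)}^q+\frac{(p-1)\,r^n}{q-1-\varkappa(q-p)}\big(\|\Phi\|_{p,Q_r(x_0)}^p+\|\Psi\|_{p,Q_r(x_0)}^p\big)^{q/p}\Big].$$ -/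

import Mathlib

open MeasureTheory

noncomputable section

/-- The open cubic interval `Q_R(x) = {y : max_i |y_i - x_i| < R}` (sides parallel to the axes,
side length `2R`). -/
def cubicInterval {n : ℕ} (x : EuclideanSpace ℝ (Fin n)) (R : ℝ) :
    Set (EuclideanSpace ℝ (Fin n)) :=
  {y | ∀ i, |y i - x i| < R}

/-- `A ⊂⊂ U`: the closure of `A` is compact and contained in `U`. -/
def CompactlyContained {n : ℕ} (A U : Set (EuclideanSpace ℝ (Fin n))) : Prop :=
  IsCompact (closure A) ∧ closure A ⊆ U

/-- The (Euclidean) distance between two sets, the infimum of the distances of their points. -/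
def setDist {n : ℕ} (A C : Set (EuclideanSpace ℝ (Fin n))) : ℝ :=
  sInf (Set.image2 dist A C)

/-- `f ∈ L^q(A)`, for a real exponent `q`, with respect to Lebesgue measure. -/
def MemLpOn {n : ℕ} (f : EuclideanSpace ℝ (Fin n) → ℝ) (q : ℝ)
    (A : Set (EuclideanSpace ℝ (Fin n))) : Prop :=
  MemLp f (ENNReal.ofReal q) (volume.restrict A)

/-- `f ∈ L^q_loc(U)`: `f ∈ L^q(K)` for every compact `K ⊆ U`. -/
def MemLpLocOn {n : ℕ} (f : EuclideanSpace ℝ (Fin n) → ℝ) (q : ℝ)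
    (U : Set (EuclideanSpace ℝ (Fin n))) : Prop :=
  ∀ K : Set (EuclideanSpace ℝ (Fin n)), IsCompact K → K ⊆ U → MemLpOn f q K

/-- The norm `‖f‖_{q,A}` of `L^q(A)`, as a real number. -/
def lpNormOn {n : ℕ} (f : EuclideanSpace ℝ (Fin n) → ℝ) (q : ℝ)
    (A : Set (EuclideanSpace ℝ (Fin n))) : ℝ :=
  lpNorm f (ENNReal.ofReal q) (volume.restrict A)

/-- The reverse Hölder inequality with increasing supports, for all cubes `Q_R(z)` with `z ∈ Ω`
and `0 < R < min {dist(z, ∂Ω) / √n, R₀}`. The distance is taken in `[0, ∞]`, so that it is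
infinite when `∂Ω` is empty. -/
def ReverseHolder {n : ℕ} (Ω : Set (EuclideanSpace ℝ (Fin n))) (p α B R₀ : ℝ)
    (Φ Ψ : EuclideanSpace ℝ (Fin n) → ℝ) : Prop :=
  ∀ z ∈ Ω, ∀ R : ℝ, 0 < R → R < R₀ →
    ENNReal.ofReal (R * √n) < Metric.infEDist z (frontier Ω) →
    1 / R ^ n * ∫ x in cubicInterval z (α * R), Φ x ^ p
      ≤ B * (1 / R ^ n * ∫ x in cubicInterval z R, Φ x) ^ p
        + 1 / R ^ n * ∫ x in cubicInterval z R, Ψ x ^ p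

/-- The constant `ϰ = (8^n + 1) 2^{3np} (B^{1/p} + 1)^p`. -/
def varkappa (n : ℕ) (p B : ℝ) : ℝ :=
  ((8 : ℝ) ^ n + 1) * (2 : ℝ) ^ (3 * n * p) * (B ^ (1 / p) + 1) ^ p

end

/-! ### Integrating level-set inequalities over the levels. -/

section LayerCake
open ENNReal Filter Topology

/-! This is Gehring's lemma. Work in the sup-norm model, where cubes are balls, on one cube Q =
Q_r(x₀), with F = Φ and G = Ψ there. Let d(x) be the distance from x to the faces of Q, and put f =
F d^{n/p}, g = G r^{n/p}. Since the weight vanishes on ∂Q, the loss of support in the reverse Hölder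
inequality does no harm, and one obtains on all of Q a level inequality (`level_inequality`):
∫_{f>t} f^p ≤ K (t^{p-1} ∫_{f>t} f + ∫_{Q∩{g>t}} g^p) whenever t^p ≥ (4n)^n ∫F^p.

Its proof is a stopping-time argument with λ = 2^n·4·(B^{1/p}+1). At almost every x with f(x) > λt,
small dyadic cubes around x have d(x)^n-weighted mean of F^p above (λt)^p, by Lebesgue
differentiation; cubes of size about d(x)/n do not, by the lower bound on t. So there is an R with a
large mean on Q_R(x) and a small one on Q_{8R}(x) (`exists_stopping_radius`). Reverse Hölder on
Q_{2R}(x) then forces a definite share of f or g on that cube to lie above t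
(`le_superlevel_of_reverse_holder`), and a Vitali covering sums these local estimates
(`setLIntegral_le_of_vitali`). The band t < f ≤ λt is estimated pointwise.

Multiplying by t^{q-p-1} and integrating over t > τ produces ∫f^q on the left and K(q-p)/(q-1) ∫f^q
on the right, which is absorbed when K(q-p) < q-1 (`gehring_lintegral`). The starting height τ =
((4n)^n ∫F^p)^{1/p} costs a factor (4n)^{n(q-p)/p} that is absent from the claim; it is paid for by
the gap between K and ϰ ≥ 2K (`rpow_mul_sub_le`). On ω one has d ≥ dist(ω, ∂Q), which removes the
weight and gives the estimate; local integrability follows by covering a compact set with small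
cubes. -/

theorem lintegral_Ioo_mul_rpow_sub_one {a τ m : ℝ} (hτ : 0 < τ) (hm : τ ≤ m) (ha : 0 < a) :
    (∫⁻ t in Set.Ioo τ m, ENNReal.ofReal (a * t ^ (a - 1))) + ENNReal.ofReal τ ^ a
      = ENNReal.ofReal m ^ a := by
  have hpos : ∀ t ∈ Set.Icc τ m, 0 < t := fun t ht => hτ.trans_le ht.1
  have hcont : ContinuousOn (fun t : ℝ => a * t ^ (a - 1)) (Set.Icc τ m) := by
    refine continuousOn_const.mul (continuousOn_id.rpow_const fun t ht => Or.inl (hpos t ht).ne')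
  have hint : IntegrableOn (fun t : ℝ => a * t ^ (a - 1)) (Set.Ioc τ m) :=
    (hcont.integrableOn_Icc).mono_set Set.Ioc_subset_Icc_self
  have hval : ∫ t in Set.Ioc τ m, a * t ^ (a - 1) = m ^ a - τ ^ a := by
    rw [← intervalIntegral.integral_of_le hm]
    refine intervalIntegral.integral_eq_sub_of_hasDerivAt (f := fun t => t ^ a) ?_ ?_
    · intro t ht
      rw [Set.uIcc_of_le hm] at ht
      exact Real.hasDerivAt_rpow_const (Or.inl (hpos t ht).ne')
    · exact (intervalIntegrable_iff_integrableOn_Ioc_of_le hm).2 hint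
  have hnonneg : 0 ≤ᵐ[volume.restrict (Set.Ioc τ m)] fun t : ℝ => a * t ^ (a - 1) := by
    filter_upwards [ae_restrict_mem measurableSet_Ioc] with t ht
    exact mul_nonneg ha.le (Real.rpow_nonneg (hτ.trans ht.1).le _)
  rw [setLIntegral_congr Ioo_ae_eq_Ioc, ← ofReal_integral_eq_lintegral_ofReal hint hnonneg, hval,
    ofReal_rpow_of_pos hτ, ofReal_rpow_of_pos (hτ.trans_le hm),
    ← ofReal_add (sub_nonneg.2 (Real.rpow_le_rpow hτ.le hm ha.le)) (Real.rpow_nonneg hτ.le _)]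
  simp

theorem lintegral_Ioo_indicator_mul_rpow {a τ N : ℝ} (hτ : 0 < τ) (hN : τ ≤ N) (ha : 0 < a)
    {y : ℝ≥0∞} (hy : ENNReal.ofReal τ < y) :
    (∫⁻ t in Set.Ioo τ N, {t | ENNReal.ofReal t < y}.indicator
        (fun t => ENNReal.ofReal (a * t ^ (a - 1))) t) + ENNReal.ofReal τ ^ a
      = min y (ENNReal.ofReal N) ^ a := by
  have hfin : min y (ENNReal.ofReal N) ≠ ⊤ := ne_top_of_le_ne_top ofReal_ne_top (min_le_right _ _)
  set m := (min y (ENNReal.ofReal N)).toReal with hm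
  have hmo : ENNReal.ofReal m = min y (ENNReal.ofReal N) := ofReal_toReal hfin
  have hτm : τ ≤ m := by
    refine (ofReal_le_iff_le_toReal hfin).1 (le_min hy.le (ofReal_le_ofReal hN))
  have hmeas : MeasurableSet {t : ℝ | ENNReal.ofReal t < y} :=
    measurableSet_lt ENNReal.measurable_ofReal measurable_const
  have hset : {t : ℝ | ENNReal.ofReal t < y} ∩ Set.Ioo τ N = Set.Ioo τ m := by
    ext t
    constructor
    · rintro ⟨h1, h2, h3⟩
      refine ⟨h2, ?_⟩
      rw [← ofReal_lt_ofReal_iff_of_nonneg (hτ.trans h2).le, hmo]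
      exact lt_min h1 ((ofReal_lt_ofReal_iff_of_nonneg (hτ.trans h2).le).2 h3)
    · rintro ⟨h2, h3⟩
      rw [← ofReal_lt_ofReal_iff_of_nonneg (hτ.trans h2).le, hmo, lt_min_iff,
        ofReal_lt_ofReal_iff_of_nonneg (hτ.trans h2).le] at h3
      exact ⟨h3.1, h2, h3.2⟩
  rw [lintegral_indicator hmeas, Measure.restrict_restrict hmeas, hset,
    lintegral_Ioo_mul_rpow_sub_one hτ hτm ha, hmo]

/-- Layer-cake formula over the super-level sets of `f` between the heights `τ` and `N`. -/
theorem lintegral_Ioo_setLIntegral_superlevel {α : Type*} [MeasurableSpace α] {μ : Measure α}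
    [SFinite μ] {f h : α → ℝ≥0∞} (hf : Measurable f) (hh : Measurable h) {a τ N : ℝ}
    (hτ : 0 < τ) (hN : τ ≤ N) (ha : 0 < a) :
    (∫⁻ t in Set.Ioo τ N, ENNReal.ofReal (a * t ^ (a - 1)) *
        ∫⁻ x in {x | ENNReal.ofReal t < f x}, h x ∂μ)
      + ENNReal.ofReal τ ^ a * ∫⁻ x in {x | ENNReal.ofReal τ < f x}, h x ∂μ
      = ∫⁻ x in {x | ENNReal.ofReal τ < f x}, h x * min (f x) (ENNReal.ofReal N) ^ a ∂μ := by
  have hE : ∀ t : ℝ, MeasurableSet {x | ENNReal.ofReal t < f x} := fun t =>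
    measurableSet_lt measurable_const hf
  have hS : MeasurableSet {z : ℝ × α | ENNReal.ofReal z.1 < f z.2} :=
    measurableSet_lt (ENNReal.measurable_ofReal.comp measurable_fst) (hf.comp measurable_snd)
  have hk : Measurable fun t : ℝ => ENNReal.ofReal (a * t ^ (a - 1)) := by fun_prop
  have key : ∀ t ∈ Set.Ioo τ N, ENNReal.ofReal (a * t ^ (a - 1)) *
      ∫⁻ x in {x | ENNReal.ofReal t < f x}, h x ∂μ
      = ∫⁻ x in {x | ENNReal.ofReal τ < f x}, {z : ℝ × α | ENNReal.ofReal z.1 < f z.2}.indicator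
          (fun z => ENNReal.ofReal (a * z.1 ^ (a - 1)) * h z.2) (t, x) ∂μ := by
    intro t ht
    have hsub : {x | ENNReal.ofReal t < f x} ⊆ {x | ENNReal.ofReal τ < f x} := fun x hx =>
      (ofReal_le_ofReal ht.1.le).trans_lt hx
    have : ∀ x, {z : ℝ × α | ENNReal.ofReal z.1 < f z.2}.indicator
          (fun z => ENNReal.ofReal (a * z.1 ^ (a - 1)) * h z.2) (t, x)
        = {x | ENNReal.ofReal t < f x}.indicator
          (fun x => ENNReal.ofReal (a * t ^ (a - 1)) * h x) x := fun x => rfl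
    simp_rw [this]
    rw [lintegral_indicator (hE t), Measure.restrict_restrict (hE t),
      Set.inter_eq_left.2 hsub, lintegral_const_mul _ hh]
  rw [setLIntegral_congr_fun measurableSet_Ioo key, lintegral_lintegral_swap]
  · rw [← lintegral_const_mul _ hh, ← lintegral_add_right _ (hh.const_mul _)]
    refine setLIntegral_congr_fun (hE τ) fun x hx => ?_
    have hx' : ENNReal.ofReal τ < f x := hx
    have : ∀ t, {z : ℝ × α | ENNReal.ofReal z.1 < f z.2}.indicator
          (fun z => ENNReal.ofReal (a * z.1 ^ (a - 1)) * h z.2) (t, x)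
        = {t | ENNReal.ofReal t < f x}.indicator
          (fun t => ENNReal.ofReal (a * t ^ (a - 1))) t * h x := by
      intro t
      by_cases ht : ENNReal.ofReal t < f x
      · rw [Set.indicator_of_mem (by exact ht), Set.indicator_of_mem (by exact ht)]
      · rw [Set.indicator_of_notMem (by exact ht), Set.indicator_of_notMem (by exact ht), zero_mul]
    simp only [this]
    rw [lintegral_mul_const _ (hk.indicator (measurableSet_lt ENNReal.measurable_ofReal
      measurable_const)), ← add_mul, lintegral_Ioo_indicator_mul_rpow hτ hN ha hx', mul_comm]
  · refine (Measurable.indicator ?_ hS).aemeasurable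
    exact (hk.comp measurable_fst).mul (hh.comp measurable_snd)

/-- The hypothesis is integrated against (q-p) t^{q-p-1} over τ < t < N. Capping one factor at N
keeps every integral finite, so the f-term on the right can be subtracted without knowing that f^q
is integrable; the bound does not depend on N. -/
theorem gehring_truncated {α : Type*} [MeasurableSpace α] {μ : Measure α}
    [SFinite μ] {f g : α → ℝ≥0∞} (hf : Measurable f) (hg : Measurable g) {p q K τ N : ℝ}
    (hp : 1 < p) (hpq : p < q) (hτ : 0 < τ) (hN : τ ≤ N) (hK : 0 ≤ K)
    (hfp : ∫⁻ x, f x ^ p ∂μ ≠ ⊤) (hgq : ∫⁻ x, g x ^ q ∂μ ≠ ⊤)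
    (hlevel : ∀ t : ℝ, τ ≤ t → ∫⁻ x in {x | ENNReal.ofReal t < f x}, f x ^ p ∂μ ≤
      ENNReal.ofReal K * (ENNReal.ofReal t ^ (p - 1) * ∫⁻ x in {x | ENNReal.ofReal t < f x}, f x ∂μ
        + ∫⁻ x in {x | ENNReal.ofReal t < g x}, g x ^ p ∂μ)) :
    (q - 1 - K * (q - p)) * (∫⁻ x in {x | ENNReal.ofReal τ < f x},
        f x ^ p * min (f x) (ENNReal.ofReal N) ^ (q - p) ∂μ).toReal
      ≤ (p - 1) * τ ^ (q - p) * (∫⁻ x in {x | ENNReal.ofReal τ < f x}, f x ^ p ∂μ).toReal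
        + K * (q - 1) * (∫⁻ x, g x ^ q ∂μ).toReal := by
  have hc : 0 < q - p := sub_pos.2 hpq
  have hq1 : 0 < q - 1 := by linarith
  have hf' : Measurable fun x => f x ^ p := hf.pow_const p
  have hg' : Measurable fun x => g x ^ p := hg.pow_const p
  have e1 := lintegral_Ioo_setLIntegral_superlevel (μ := μ) hf hf' hτ hN hc
  have e2 := lintegral_Ioo_setLIntegral_superlevel (μ := μ) hf hf hτ hN hq1
  have e3 := lintegral_Ioo_setLIntegral_superlevel (μ := μ) hg hg' hτ hN hc
  have hlevτ := hlevel τ le_rfl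
  set E := {x | ENNReal.ofReal τ < f x} with hEdef
  set P := ∫⁻ x in E, f x ^ p ∂μ with hP
  set W := ∫⁻ x in {x | ENNReal.ofReal τ < g x}, g x ^ p ∂μ
  set Lf := ∫⁻ x in E, f x ∂μ
  set A := ∫⁻ x in E, f x ^ p * min (f x) (ENNReal.ofReal N) ^ (q - p) ∂μ with hA
  set A2 := ∫⁻ x in E, f x * min (f x) (ENNReal.ofReal N) ^ (q - 1) ∂μ with hA2
  set S := ∫⁻ x in {x | ENNReal.ofReal τ < g x},
    g x ^ p * min (g x) (ENNReal.ofReal N) ^ (q - p) ∂μ with hS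
  set J1 := ∫⁻ t in Set.Ioo τ N, ENNReal.ofReal ((q - p) * t ^ (q - p - 1)) *
        ∫⁻ x in {x | ENNReal.ofReal t < f x}, f x ^ p ∂μ with hJ1
  set J2 := ∫⁻ t in Set.Ioo τ N, ENNReal.ofReal ((q - 1) * t ^ (q - 1 - 1)) *
        ∫⁻ x in {x | ENNReal.ofReal t < f x}, f x ∂μ with hJ2
  set J3 := ∫⁻ t in Set.Ioo τ N, ENNReal.ofReal ((q - p) * t ^ (q - p - 1)) *
        ∫⁻ x in {x | ENNReal.ofReal t < g x}, g x ^ p ∂μ with hJ3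
  have hPtop : P ≠ ⊤ := ne_top_of_le_ne_top hfp (setLIntegral_le_lintegral _ _)
  have hAtop : A ≠ ⊤ := by
    have : A ≤ P * ENNReal.ofReal N ^ (q - p) := by
      rw [hA, hP, ← lintegral_mul_const _ hf']
      gcongr
      exact min_le_right _ _
    exact ne_top_of_le_ne_top (mul_ne_top hPtop (rpow_ne_top_of_nonneg hc.le ofReal_ne_top)) this
  -- Pointwise, f · min(f,N)^{q-1} = f · min(f,N)^{p-1} · min(f,N)^{q-p}, and min(f,N) ≤ f. This is
  -- what allows absorption into the left side.
  have hA2A : A2 ≤ A := by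
    refine lintegral_mono fun x => ?_
    have h1 : q - 1 = (p - 1) + (q - p) := by ring
    have h2 : f x ^ p = f x * f x ^ (p - 1) := by
      conv_lhs => rw [show p = 1 + (p - 1) by ring, rpow_add_of_nonneg _ _ zero_le_one
        (by linarith), rpow_one]
    rw [h1, rpow_add_of_nonneg _ _ (by linarith) hc.le, h2, mul_assoc]
    have h3 : min (f x) (ENNReal.ofReal N) ^ (p - 1) ≤ f x ^ (p - 1) :=
      rpow_le_rpow (min_le_left _ _) (by linarith)
    gcongr
  have hSle : S ≤ ∫⁻ x, g x ^ q ∂μ := by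
    refine (lintegral_mono fun x => ?_).trans (setLIntegral_le_lintegral _ _)
    have h1 : g x ^ q = g x ^ p * g x ^ (q - p) := by
      rw [← rpow_add_of_nonneg _ _ (by linarith) hc.le]; congr 1; ring
    rw [h1]
    gcongr
    exact min_le_left _ _
  have hA2top := ne_top_of_le_ne_top hAtop hA2A
  have hStop := ne_top_of_le_ne_top hgq hSle
  have hτ0 : ∀ a : ℝ, ENNReal.ofReal τ ^ a ≠ 0 := fun a => by
    rw [ofReal_rpow_of_pos hτ]; exact (ofReal_pos.2 (Real.rpow_pos_of_pos hτ _)).ne'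
  have hτR : ∀ a : ℝ, (ENNReal.ofReal τ ^ a).toReal = τ ^ a := fun a => by
    rw [ofReal_rpow_of_pos hτ, toReal_ofReal (Real.rpow_nonneg hτ.le _)]
  -- Since τ > 0, finiteness of the right side of a layer-cake identity passes to both pieces on the
  -- left; in particular f is integrable over {f > τ} although only f^p was assumed integrable.
  have fin : ∀ {u v w z : ℝ≥0∞}, u + v * w = z → z ≠ ⊤ → v ≠ 0 → u ≠ ⊤ ∧ w ≠ ⊤ ∧
      u.toReal + v.toReal * w.toReal = z.toReal := by
    rintro u v w z rfl h hv
    rw [add_ne_top] at h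
    refine ⟨h.1, fun hw => h.2 (by rw [hw, mul_top hv]), ?_⟩
    rw [toReal_add h.1 h.2, toReal_mul]
  obtain ⟨hJ1top, -, r1⟩ := fin e1 hAtop (hτ0 _)
  obtain ⟨hJ2top, hLtop, r2⟩ := fin e2 hA2top (hτ0 _)
  obtain ⟨hJ3top, hWtop, r3⟩ := fin e3 hStop (hτ0 _)
  rw [hτR] at r1 r2 r3
  have hmono : ∀ (u : α → ℝ≥0∞) (v : α → ℝ≥0∞), Measurable u → Measurable fun t : ℝ =>
      ∫⁻ x in {x | ENNReal.ofReal t < u x}, v x ∂μ := by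
    intro u v _
    have : Antitone fun t : ℝ => ∫⁻ x in {x | ENNReal.ofReal t < u x}, v x ∂μ := fun s t hst =>
      lintegral_mono_set fun x hx => (ofReal_le_ofReal hst).trans_lt hx
    exact this.measurable
  have hJ : J1 ≤ ENNReal.ofReal (K * (q - p) / (q - 1)) * J2 + ENNReal.ofReal K * J3 := by
    have mJ2 : Measurable fun t : ℝ => ENNReal.ofReal ((q - 1) * t ^ (q - 1 - 1)) *
        ∫⁻ x in {x | ENNReal.ofReal t < f x}, f x ∂μ :=
      (by fun_prop : Measurable fun t : ℝ => ENNReal.ofReal ((q - 1) * t ^ (q - 1 - 1))).mul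
        (hmono f f hf)
    have mJ3 : Measurable fun t : ℝ => ENNReal.ofReal ((q - p) * t ^ (q - p - 1)) *
        ∫⁻ x in {x | ENNReal.ofReal t < g x}, g x ^ p ∂μ :=
      (by fun_prop : Measurable fun t : ℝ => ENNReal.ofReal ((q - p) * t ^ (q - p - 1))).mul
        (hmono g _ hg)
    rw [hJ1, hJ2, hJ3, ← lintegral_const_mul _ mJ2, ← lintegral_const_mul _ mJ3,
      ← lintegral_add_left (mJ2.const_mul _)]
    refine setLIntegral_mono' measurableSet_Ioo fun t ht => ?_
    have ht0 : 0 < t := hτ.trans ht.1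
    refine (mul_le_mul_right (hlevel t ht.1.le) _).trans (le_of_eq ?_)
    rw [mul_add, mul_add, ofReal_rpow_of_pos ht0]
    congr 1
    · simp only [← mul_assoc]
      congr 1
      rw [← ofReal_mul (by positivity), ← ofReal_mul (by positivity), ← ofReal_mul (by positivity)]
      congr 1
      have : t ^ (q - 1 - 1) = t ^ (q - p - 1) * t ^ (p - 1) := by
        rw [← Real.rpow_add ht0]; congr 1; ring
      rw [this]
      field_simp
    · ring
  have hJr : J1.toReal ≤ K * (q - p) / (q - 1) * J2.toReal + K * J3.toReal := by
    have := toReal_mono (add_ne_top.2 ⟨mul_ne_top ofReal_ne_top hJ2top,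
      mul_ne_top ofReal_ne_top hJ3top⟩) hJ
    rwa [toReal_add (mul_ne_top ofReal_ne_top hJ2top) (mul_ne_top ofReal_ne_top hJ3top),
      toReal_mul, toReal_mul, toReal_ofReal (by positivity), toReal_ofReal hK] at this
  have hPr : P.toReal ≤ K * (τ ^ (p - 1) * Lf.toReal + W.toReal) := by
    have h1 := mul_ne_top (rpow_ne_top_of_nonneg (by linarith : 0 ≤ p - 1)
      (ofReal_ne_top (r := τ))) hLtop
    have := toReal_mono (mul_ne_top ofReal_ne_top (add_ne_top.2 ⟨h1, hWtop⟩)) hlevτ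
    rwa [toReal_mul, toReal_ofReal hK, toReal_add h1 hWtop, toReal_mul, hτR] at this
  have hA2r : A2.toReal ≤ A.toReal := toReal_mono hAtop hA2A
  have hSr := toReal_mono hgq hSle
  have hτq : τ ^ (q - 1) = τ ^ (q - p) * τ ^ (p - 1) := by
    rw [← Real.rpow_add hτ]; congr 1; ring
  rw [hτq] at r2
  have hT : 0 < τ ^ (q - p) := Real.rpow_pos_of_pos hτ _
  have hJr' : (q - 1) * J1.toReal ≤ K * (q - p) * J2.toReal + K * (q - 1) * J3.toReal := by
    have := mul_le_mul_of_nonneg_left hJr hq1.le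
    have e : (q - 1) * (K * (q - p) / (q - 1) * J2.toReal + K * J3.toReal)
      = K * (q - p) * J2.toReal + K * (q - 1) * J3.toReal := by field_simp
    linarith
  have hW0 : 0 ≤ W.toReal := toReal_nonneg
  have i1 : K * (q - p) * A2.toReal ≤ K * (q - p) * A.toReal := by gcongr
  have i2 : K * (q - 1) * S.toReal ≤ K * (q - 1) * (∫⁻ x, g x ^ q ∂μ).toReal := by gcongr
  -- The level inequality at t = τ itself: writing q-1 = (p-1) + (q-p), the (q-p)-share of the
  -- boundary term in P cancels against the boundary term in Lf, leaving the coefficient p-1 and a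
  -- nonpositive multiple of W.
  have i3 : (q - p) * τ ^ (q - p) * P.toReal
      ≤ (q - p) * τ ^ (q - p) * (K * (τ ^ (p - 1) * Lf.toReal + W.toReal)) := by gcongr
  have i4 : 0 ≤ K * (p - 1) * τ ^ (q - p) * W.toReal := by
    have : 0 ≤ p - 1 := by linarith
    positivity
  have j1 : J1.toReal = A.toReal - τ ^ (q - p) * P.toReal := by linarith
  have j2 : J2.toReal = A2.toReal - τ ^ (q - p) * τ ^ (p - 1) * Lf.toReal := by linarith
  have j3 : J3.toReal = S.toReal - τ ^ (q - p) * W.toReal := by linarith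
  rw [j1, j2, j3] at hJr'
  linarith

/-- Integrating a reverse Hölder type inequality on super-level sets over the levels. -/
theorem gehring_lintegral {α : Type*} [MeasurableSpace α] {μ : Measure α}
    [SFinite μ] {f g : α → ℝ≥0∞} (hf : Measurable f) (hg : Measurable g) {p q K τ : ℝ}
    (hp : 1 < p) (hpq : p < q) (hτ : 0 < τ) (hK : 1 ≤ K) (hKq : K * (q - p) < q - 1)
    (hfp : ∫⁻ x, f x ^ p ∂μ ≠ ⊤) (hgq : ∫⁻ x, g x ^ q ∂μ ≠ ⊤)
    (hlevel : ∀ t : ℝ, τ ≤ t → ∫⁻ x in {x | ENNReal.ofReal t < f x}, f x ^ p ∂μ ≤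
      ENNReal.ofReal K * (ENNReal.ofReal t ^ (p - 1) * ∫⁻ x in {x | ENNReal.ofReal t < f x}, f x ∂μ
        + ∫⁻ x in {x | ENNReal.ofReal t < g x}, g x ^ p ∂μ)) :
    ∫⁻ x, f x ^ q ∂μ ≠ ⊤ ∧ (q - 1 - K * (q - p)) * (∫⁻ x, f x ^ q ∂μ).toReal
      ≤ (p - 1) * τ ^ (q - p) * (∫⁻ x, f x ^ p ∂μ).toReal
        + K * (q - 1) * (∫⁻ x, g x ^ q ∂μ).toReal := by
  have hc : 0 < q - p := sub_pos.2 hpq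
  set D := q - 1 - K * (q - p) with hD
  have hD0 : 0 < D := by linarith
  have hsplit : ∀ x, f x ^ q = f x ^ p * f x ^ (q - p) := fun x => by
    rw [← rpow_add_of_nonneg _ _ (by linarith) hc.le]; congr 1; ring
  set E := {x | ENNReal.ofReal τ < f x} with hEdef
  have hE : MeasurableSet E := measurableSet_lt measurable_const hf
  set P := ∫⁻ x in E, f x ^ p ∂μ with hP
  have hPtop : P ≠ ⊤ := ne_top_of_le_ne_top hfp (setLIntegral_le_lintegral _ _)
  set P' := ∫⁻ x in Eᶜ, f x ^ p ∂μ with hP'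
  have hPtop' : P' ≠ ⊤ := ne_top_of_le_ne_top hfp (setLIntegral_le_lintegral _ _)
  have hPP : P.toReal + P'.toReal = (∫⁻ x, f x ^ p ∂μ).toReal := by
    rw [← lintegral_add_compl _ hE, toReal_add hPtop hPtop']
  set M := ((p - 1) * τ ^ (q - p) * P.toReal
        + K * (q - 1) * (∫⁻ x, g x ^ q ∂μ).toReal) / D with hM
  have hA : ∀ k : ℕ, ∫⁻ x in E, f x ^ p * min (f x) (ENNReal.ofReal (τ + k)) ^ (q - p) ∂μ
      ≤ ENNReal.ofReal M := by
    intro k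
    have h := gehring_truncated hf hg hp hpq hτ (by simp : τ ≤ τ + k) (by linarith) hfp hgq hlevel
    have hfin : ∫⁻ x in E, f x ^ p * min (f x) (ENNReal.ofReal (τ + k)) ^ (q - p) ∂μ ≠ ⊤ := by
      refine ne_top_of_le_ne_top (mul_ne_top hPtop (rpow_ne_top_of_nonneg hc.le
        (ofReal_ne_top (r := τ + k)))) ?_
      rw [hP, ← lintegral_mul_const _ (hf.pow_const p)]
      gcongr
      exact min_le_right _ _
    rw [← ofReal_toReal hfin]
    refine ofReal_le_ofReal ?_
    rw [hM, le_div_iff₀ hD0, mul_comm]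
    exact h
  have hlim : Tendsto (fun k : ℕ => ∫⁻ x in E,
      f x ^ p * min (f x) (ENNReal.ofReal (τ + k)) ^ (q - p) ∂μ) atTop
      (𝓝 (∫⁻ x in E, f x ^ q ∂μ)) := by
    refine lintegral_tendsto_of_tendsto_of_monotone
      (fun k => ((hf.pow_const p).mul ((hf.min measurable_const).pow_const _)).aemeasurable)
      (Eventually.of_forall fun x => ?_) (Eventually.of_forall fun x => ?_)
    · intro k l hkl
      have : (k : ℝ) ≤ l := by exact_mod_cast hkl
      dsimp only
      gcongr
    · rw [hsplit x]
      have hkt : Tendsto (fun k : ℕ => ENNReal.ofReal (τ + k)) atTop (𝓝 ⊤) :=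
        tendsto_ofReal_atTop.comp (tendsto_atTop_add_const_left _ _ tendsto_natCast_atTop_atTop)
      have h1 : Tendsto (fun k : ℕ => min (f x) (ENNReal.ofReal (τ + k))) atTop (𝓝 (f x)) := by
        simpa using (tendsto_const_nhds (x := f x)).min hkt
      have h2 := (ENNReal.continuous_rpow_const (y := q - p)).continuousAt.tendsto.comp h1
      -- Where f = ∞ the constant factor is infinite, so passing to the limit needs a nonzero limit
      -- of the other factor.
      by_cases hfx : f x = 0
      · simp [hfx, show 0 < p by linarith]
      · refine ENNReal.Tendsto.const_mul h2 (Or.inl ?_)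
        intro h0
        rw [rpow_eq_zero_iff] at h0
        rcases h0 with ⟨h, -⟩ | ⟨-, h⟩
        · exact hfx h
        · linarith
  have hEq : ∫⁻ x in E, f x ^ q ∂μ ≤ ENNReal.ofReal M := le_of_tendsto' hlim hA
  have hEtop := ne_top_of_le_ne_top ofReal_ne_top hEq
  have hCq : ∫⁻ x in Eᶜ, f x ^ q ∂μ ≤ P' * ENNReal.ofReal τ ^ (q - p) := by
    rw [hP', ← lintegral_mul_const _ (hf.pow_const p)]
    refine setLIntegral_mono' hE.compl fun x hx => ?_
    have hx' : f x ≤ ENNReal.ofReal τ := not_lt.1 hx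
    rw [hsplit x]
    gcongr
  have hmt := mul_ne_top hPtop' (rpow_ne_top_of_nonneg hc.le (ofReal_ne_top (r := τ)))
  have hCtop := ne_top_of_le_ne_top hmt hCq
  have hM0 : 0 ≤ M := by
    have h1 : 0 ≤ p - 1 := by linarith
    have h2 : 0 ≤ q - 1 := by linarith
    positivity
  have hsum := lintegral_add_compl (fun x => f x ^ q) hE (μ := μ)
  refine ⟨?_, ?_⟩
  · rw [← hsum]; exact add_ne_top.2 ⟨hEtop, hCtop⟩
  rw [← hsum, toReal_add hEtop hCtop]
  have a1 := toReal_mono ofReal_ne_top hEq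
  rw [toReal_ofReal hM0, hM, le_div_iff₀ hD0] at a1
  have a2 := toReal_mono hmt hCq
  rw [toReal_mul, ofReal_rpow_of_pos hτ, toReal_ofReal (Real.rpow_nonneg hτ.le _)] at a2
  -- From K ≥ 1. Hence the part {f ≤ τ}, where f^q ≤ τ^{q-p} f^p, fits under the same coefficient
  -- p-1 and merges with the part above τ.
  have hDp : D ≤ p - 1 := by
    rw [hD]; nlinarith
  have hT : 0 < τ ^ (q - p) := Real.rpow_pos_of_pos hτ _
  have a3 : D * (∫⁻ x in Eᶜ, f x ^ q ∂μ).toReal ≤ (p - 1) * (P'.toReal * τ ^ (q - p)) :=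
    mul_le_mul hDp a2 toReal_nonneg (by linarith)
  rw [← hPP]
  linarith

end LayerCake

/-! ### Stopping cubes, absorption and covering. -/

section LevelSets
open ENNReal Filter Topology Metric

/-- Bernoulli: (1 - 1/(2n))^n ≥ 1/2. This is why cubes of radius at most d/(2n) are used: there d^n
varies by at most a factor 2. -/
theorem pow_le_two_mul_pow {n : ℕ} (hn : 1 ≤ n) {a c : ℝ} (ha : 0 ≤ a)
    (h : (1 - 1 / (2 * n)) * a ≤ c) : a ^ n ≤ 2 * c ^ n := by
  have hn' : (1 : ℝ) ≤ n := by exact_mod_cast hn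
  have hu : 1 / (2 * (n : ℝ)) ≤ 1 / 2 := by
    apply one_div_le_one_div_of_le <;> linarith
  have hb : (1 : ℝ) / 2 ≤ (1 - 1 / (2 * n)) ^ n := by
    have := one_add_mul_le_pow (a := -(1 / (2 * (n : ℝ)))) (by linarith) n
    have e : 1 + (n : ℝ) * -(1 / (2 * n)) = 1 / 2 := by field_simp; norm_num
    rw [e] at this
    simpa [sub_eq_add_neg] using this
  have h1 : ((1 - 1 / (2 * n)) * a) ^ n ≤ c ^ n := pow_le_pow_left₀ (mul_nonneg (by linarith) ha) h n
  rw [mul_pow] at h1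
  have h2 : 1 / 2 * a ^ n ≤ (1 - 1 / (2 * (n : ℝ))) ^ n * a ^ n := by gcongr
  linarith

theorem ofReal_pow_le_two_mul {n : ℕ} (hn : 1 ≤ n) {a c : ℝ} (ha : 0 ≤ a) (hc : 0 ≤ c)
    (h : (1 - 1 / (2 * n)) * a ≤ c) :
    ENNReal.ofReal a ^ n ≤ 2 * ENNReal.ofReal c ^ n := by
  rw [← ofReal_pow ha, ← ofReal_pow hc, show (2 : ℝ≥0∞) = ENNReal.ofReal 2 by simp,
    ← ofReal_mul zero_le_two]
  exact ofReal_le_ofReal (pow_le_two_mul_pow hn ha h)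

section Cubes
variable {n : ℕ}

theorem volume_ball_fin (x : Fin n → ℝ) {R : ℝ} (hR : 0 < R) :
    volume (ball x R) = ENNReal.ofReal (2 * R) ^ n := by
  rw [Real.volume_pi_ball x hR, ofReal_pow (by positivity), Fintype.card_fin]

theorem volume_ball_two_mul (x : Fin n → ℝ) {R : ℝ} (hR : 0 < R) :
    volume (ball x (2 * R)) = 2 ^ n * volume (ball x R) := by
  rw [volume_ball_fin x hR, volume_ball_fin x (by positivity), ofReal_mul zero_le_two, mul_pow]
  simp

theorem closedBall_ae_eq_ball_fin [NeZero n] (x : Fin n → ℝ) (R : ℝ) :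
    closedBall x R =ᵐ[volume] ball x R := by
  have : Nontrivial (Fin n → ℝ) := Function.nontrivial
  have h : (sphere x R : Set (Fin n → ℝ)) =ᵐ[volume] (∅ : Set (Fin n → ℝ)) :=
    ae_eq_empty.2 (Measure.addHaar_sphere volume x R)
  simpa [ball_union_sphere] using (ae_eq_refl (ball x R)).union h

/-- Lebesgue differentiation. The exceptional null set is independent of ρ, because the initial
radius will be chosen depending on x. -/
theorem ae_tendsto_lintegral_ball_div_volume [NeZero n] {H : (Fin n → ℝ) → ℝ≥0∞}
    (hH : Measurable H) (hfin : ∫⁻ y, H y ≠ ⊤) :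
    ∀ᵐ x, ∀ ρ : ℝ, 0 < ρ → Tendsto (fun k : ℕ => (∫⁻ y in ball x (ρ * (1 / 2) ^ k), H y) /
      volume (ball x (ρ * (1 / 2) ^ k))) atTop (𝓝 (H x)) := by
  filter_upwards [VitaliFamily.ae_tendsto_lintegral_div
    (IsUnifLocDoublingMeasure.vitaliFamily (volume : Measure (Fin n → ℝ)) 1) hH.aemeasurable hfin]
    with x hx ρ hρ
  have h0 : Tendsto (fun k : ℕ => ρ * (1 / 2 : ℝ) ^ k) atTop (𝓝[>] 0) := by
    refine tendsto_nhdsWithin_iff.2 ⟨?_, Eventually.of_forall fun k => by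
      simp only [Set.mem_Ioi]; positivity⟩
    simpa using (tendsto_pow_atTop_nhds_zero_of_lt_one (by norm_num) (by norm_num :
      (1 / 2 : ℝ) < 1)).const_mul ρ
  have h1 := IsUnifLocDoublingMeasure.tendsto_closedBall_filterAt
    (volume : Measure (Fin n → ℝ)) (K := 1) (x := x) (fun _ : ℕ => x) _ h0
    (Eventually.of_forall fun k => mem_closedBall_self (by positivity))
  refine (hx.comp h1).congr fun k => ?_
  simp only [Function.comp]
  rw [setLIntegral_congr (closedBall_ae_eq_ball_fin _ _),
    measure_congr (closedBall_ae_eq_ball_fin _ _)]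

/-- Dyadic stopping time: the largest dyadic cube around `x` on which the weighted mean value of
`H` exceeds `σ`. -/
theorem exists_stopping_radius {H : (Fin n → ℝ) → ℝ≥0∞} {w σ : ℝ≥0∞} (hw : w ≠ ⊤)
    {x : Fin n → ℝ} {ρ : ℝ} (hρ : 0 < ρ)
    (hlim : Tendsto (fun k : ℕ => (∫⁻ y in ball x (ρ * (1 / 2) ^ k), H y) /
      volume (ball x (ρ * (1 / 2) ^ k))) atTop (𝓝 (H x)))
    (hσ : σ < w * H x)
    (hlarge : ∀ R, ρ / 4 ≤ R → w * ∫⁻ y in ball x R, H y ≤ σ * volume (ball x R)) :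
    ∃ R, 0 < R ∧ 8 * R ≤ ρ ∧ σ * volume (ball x R) < w * ∫⁻ y in ball x R, H y ∧
      w * ∫⁻ y in ball x (8 * R), H y ≤ σ * volume (ball x (8 * R)) := by
  classical
  have hex : ∃ k : ℕ, σ * volume (ball x (ρ * (1 / 2) ^ k)) <
      w * ∫⁻ y in ball x (ρ * (1 / 2) ^ k), H y := by
    have h := ENNReal.Tendsto.const_mul hlim (Or.inr hw)
    obtain ⟨k, hk⟩ := (h.eventually (lt_mem_nhds hσ)).exists
    refine ⟨k, ?_⟩
    have hpos : 0 < ρ * (1 / 2) ^ k := by positivity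
    rw [← mul_div_assoc] at hk
    exact (ENNReal.lt_div_iff_mul_lt (Or.inl (measure_ball_pos _ _ hpos).ne')
      (Or.inl measure_ball_lt_top.ne)).1 hk
  have hk := Nat.find_spec hex
  have hmin := fun m => Nat.find_min (m := m) hex
  set k := Nat.find hex
  -- The first three dyadic radii ρ, ρ/2, ρ/4 are excluded by `hlarge`, so three doublings, a factor
  -- 8, lead back to a radius that was tested and rejected.
  have hk3 : 3 ≤ k := by
    by_contra h
    refine absurd hk (not_lt.2 (hlarge _ ?_))
    have : (1 / 2 : ℝ) ^ 2 ≤ (1 / 2) ^ k :=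
      pow_le_pow_of_le_one (by norm_num) (by norm_num) (by omega)
    nlinarith
  obtain ⟨j, hj⟩ := Nat.exists_eq_add_of_le hk3
  have h8 : 8 * (ρ * (1 / 2) ^ k) = ρ * (1 / 2) ^ j := by rw [hj, pow_add]; ring
  refine ⟨ρ * (1 / 2) ^ k, by positivity, ?_, hk, ?_⟩
  · rw [h8]
    exact mul_le_of_le_one_right hρ.le (pow_le_one₀ (by norm_num) (by norm_num))
  · rw [h8]
    exact not_lt.1 (hmin j (by omega))

end Cubes

theorem setLIntegral_le_mul_add_superlevel {α : Type*} [MeasurableSpace α] {μ : Measure α}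
    {f h : α → ℝ≥0∞} (hf : Measurable f) {A : Set α} {t c : ℝ≥0∞}
    (hle : ∀ x, f x ≤ t → h x ≤ c) :
    ∫⁻ x in A, h x ∂μ ≤ c * μ A + ∫⁻ x in A ∩ {x | t < f x}, h x ∂μ := by
  have hE : MeasurableSet {x | t < f x} := measurableSet_lt measurable_const hf
  rw [← lintegral_inter_add_sdiff h A hE, add_comm]
  gcongr
  calc ∫⁻ x in A \ {x | t < f x}, h x ∂μ ≤ ∫⁻ x in A \ {x | t < f x}, c ∂μ := by
        rw [Set.sdiff_eq, Set.inter_comm, ← Measure.restrict_restrict hE.compl]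
        exact setLIntegral_mono measurable_const fun x hx => hle x (not_lt.1 hx)
    _ ≤ c * μ A := by
        rw [setLIntegral_const]
        gcongr
        exact Set.sdiff_subset

/-- Absorption: a reverse Hölder inequality on a cube whose small-scale mean exceeds the level
`λ t` forces a share of the mass of `f` or `g` to lie above the level `t`. -/
theorem le_superlevel_of_reverse_holder {n : ℕ} {p : ℝ} (hp : 1 < p)
    {b t N I₀ I₁ I₂ u v w w' : ℝ≥0∞}
    (hN : N ≠ ⊤) (hN0 : N ≠ 0) (hw : w' ^ p = w)
    (hRH : I₀ ≤ N * (b * (N⁻¹ * I₁)) ^ p + I₂)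
    (hI₁ : w' * I₁ ≤ 2 * (t * (2 ^ n * N) + u)) (hI₂ : w * I₂ ≤ t ^ p * (2 ^ n * N) + v)
    (hI₀ : (2 ^ n * 4 * (b + 1) * t) ^ p * N < w * I₀) :
    t ^ p * (2 ^ n * N) ≤ t ^ (p - 1) * u + v := by
  have hp0 : 0 ≤ p := by linarith
  have htp : t ^ p = t ^ (p - 1) * t := by
    conv_lhs => rw [show p = (p - 1) + 1 by ring, rpow_add_of_nonneg _ _ (by linarith) zero_le_one,
      rpow_one]
  -- If the claim fails, then u and v are bounded by the trivial terms t·2^n N and t^p·2^n N. With c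
  -- = 2^n·4·t, reverse Hölder then gives w I₀ ≤ N((bc)^p + c^p) ≤ N((b+1)c)^p, contradicting `hI₀`.
  by_contra hcon
  rw [not_le] at hcon
  have hu : u ≤ t * (2 ^ n * N) := by
    by_contra h
    refine absurd hcon (not_lt.2 ?_)
    rw [htp, mul_assoc]
    exact (mul_le_mul_right (not_le.1 h).le _).trans le_self_add
  have hv : v ≤ t ^ p * (2 ^ n * N) := (le_add_self.trans_lt hcon).le
  set c : ℝ≥0∞ := 2 ^ n * 4 * t with hc
  have h1 : N⁻¹ * (w' * I₁) ≤ c := by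
    calc N⁻¹ * (w' * I₁) ≤ N⁻¹ * (2 * (t * (2 ^ n * N) + t * (2 ^ n * N))) := by
          exact mul_le_mul_right (hI₁.trans (by gcongr)) _
      _ = (N⁻¹ * N) * c := by rw [hc]; ring
      _ = c := by rw [ENNReal.inv_mul_cancel hN0 hN, one_mul]
  have h2 : w * I₂ ≤ N * c ^ p := by
    calc w * I₂ ≤ t ^ p * (2 ^ n * N) + t ^ p * (2 ^ n * N) := hI₂.trans (by gcongr)
      _ = N * ((2 ^ n * 2) * t ^ p) := by ring
      _ ≤ N * ((2 ^ n * 4) ^ p * t ^ p) := by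
          gcongr
          have h4 : (1 : ℝ≥0∞) ≤ 2 ^ n * 4 := by
            have : (1 : ℝ≥0∞) ≤ 2 ^ n := one_le_pow₀ one_le_two
            exact this.trans (le_mul_of_one_le_right (zero_le) (by norm_num))
          calc (2 : ℝ≥0∞) ^ n * 2 ≤ 2 ^ n * 4 := by gcongr; norm_num
            _ = (2 ^ n * 4) ^ (1 : ℝ) := (rpow_one _).symm
            _ ≤ (2 ^ n * 4) ^ p := rpow_le_rpow_of_exponent_le h4 hp.le
      _ = N * c ^ p := by rw [hc, mul_rpow_of_nonneg (2 ^ n * 4) t hp0]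
  have h3 : w * I₀ ≤ (2 ^ n * 4 * (b + 1) * t) ^ p * N := by
    calc w * I₀ ≤ w * (N * (b * (N⁻¹ * I₁)) ^ p + I₂) := by gcongr
      _ = N * (b * (N⁻¹ * (w' * I₁))) ^ p + w * I₂ := by
          rw [← hw, mul_add, show b * (N⁻¹ * (w' * I₁)) = w' * (b * (N⁻¹ * I₁)) by ring,
            mul_rpow_of_nonneg w' _ hp0]
          ring
      _ ≤ N * (b * c) ^ p + N * c ^ p := by gcongr
      _ = N * ((b * c) ^ p + c ^ p) := by ring
      _ ≤ N * (b * c + c) ^ p := by gcongr; exact add_rpow_le_rpow_add _ _ hp.le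
      _ = (2 ^ n * 4 * (b + 1) * t) ^ p * N := by
          rw [hc, mul_comm]; congr 2; ring
  exact absurd hI₀ (not_lt.2 h3)

/-- Vitali covering by cubes, in integrated form. -/
theorem setLIntegral_le_of_vitali {n : ℕ} {S : Set (Fin n → ℝ)} {R : (Fin n → ℝ) → ℝ} {M : ℝ}
    (hR : ∀ x ∈ S, 0 < R x) (hM : ∀ x ∈ S, R x ≤ M) {h k : (Fin n → ℝ) → ℝ≥0∞}
    (hle : ∀ x ∈ S, ∫⁻ y in ball x (8 * R x), h y ≤ ∫⁻ y in ball x (2 * R x), k y) :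
    ∫⁻ x in S, h x ≤ ∫⁻ x, k x := by
  -- A selected centre c meeting the cube of a has R a ≤ 2 R c, so dist(a, c) < 2 R a + 2 R c ≤ 6 R
  -- c. Only the centres need covering; 8 is the next power of 2, matching the dyadic stopping
  -- radii.
  obtain ⟨u, huS, hdisj, hcov⟩ := Vitali.exists_disjoint_subfamily_covering_enlargement
    (fun x => ball x (2 * R x)) S R 2 one_lt_two (fun x hx => (hR x hx).le) M hM
    (fun x hx => ⟨x, mem_ball_self (by linarith [hR x hx])⟩)
  have hcount : u.Countable := hdisj.countable_of_isOpen (fun x _ => isOpen_ball)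
    (fun x hx => ⟨x, mem_ball_self (by linarith [hR x (huS hx)])⟩)
  have hsub : S ⊆ ⋃ x ∈ u, ball x (8 * R x) := by
    intro a ha
    obtain ⟨c, hc, ⟨y, hya, hyc⟩, hac⟩ := hcov a ha
    refine Set.mem_iUnion₂.2 ⟨c, hc, ?_⟩
    rw [mem_ball] at hya hyc ⊢
    have := dist_triangle_left a c y
    linarith [hR c (huS hc)]
  have := hcount.to_subtype
  calc ∫⁻ x in S, h x ≤ ∫⁻ x in ⋃ x ∈ u, ball x (8 * R x), h x := lintegral_mono_set hsub
    _ ≤ ∑' x : u, ∫⁻ y in ball (x : Fin n → ℝ) (8 * R x), h y := by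
        rw [Set.biUnion_eq_iUnion]; exact lintegral_iUnion_le _ _
    _ ≤ ∑' x : u, ∫⁻ y in ball (x : Fin n → ℝ) (2 * R x), k y :=
        ENNReal.tsum_le_tsum fun x => hle x (huS x.2)
    _ = ∫⁻ y in ⋃ x ∈ u, ball x (2 * R x), k y :=
        (lintegral_biUnion hcount (fun x _ => measurableSet_ball) hdisj k).symm
    _ ≤ ∫⁻ x, k x := setLIntegral_le_lintegral _ _

end LevelSets

/-! ### The level inequality for the weighted functions. -/

section LevelInequality
open ENNReal Filter Topology Metric

variable {n : ℕ}

/-- The product of a function with the power `n / p` of the distance to the boundary of the cube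
`ball x₀ r`; it vanishes outside of that cube. -/
noncomputable def boundaryWeighted (F : (Fin n → ℝ) → ℝ≥0∞) (p : ℝ) (x₀ : Fin n → ℝ) (r : ℝ)
    (x : Fin n → ℝ) : ℝ≥0∞ :=
  F x * ENNReal.ofReal (r - dist x x₀) ^ (n / p)

theorem measurable_boundaryWeighted {F : (Fin n → ℝ) → ℝ≥0∞} (hF : Measurable F) (p : ℝ)
    (x₀ : Fin n → ℝ) (r : ℝ) : Measurable (boundaryWeighted F p x₀ r) := by
  unfold boundaryWeighted
  fun_prop

theorem mul_rpow_div_rpow {p : ℝ} (hp : 0 < p) (a c : ℝ≥0∞) :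
    (a * c ^ (n / p)) ^ p = a ^ p * c ^ n := by
  rw [mul_rpow_of_nonneg _ _ hp.le, ← rpow_mul, div_mul_cancel₀ _ hp.ne', rpow_natCast]

theorem boundaryWeighted_rpow {p : ℝ} (hp : 0 < p) (F : (Fin n → ℝ) → ℝ≥0∞) (x₀ : Fin n → ℝ)
    (r : ℝ) (x : Fin n → ℝ) :
    boundaryWeighted F p x₀ r x ^ p = F x ^ p * ENNReal.ofReal (r - dist x x₀) ^ n :=
  mul_rpow_div_rpow hp _ _

theorem weight_comparable (hn : 1 ≤ n) {x₀ x y : Fin n → ℝ} {r : ℝ} (hx : 0 < r - dist x x₀)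
    (hxy : dist y x < (r - dist x x₀) / (2 * n)) :
    ENNReal.ofReal (r - dist x x₀) ^ n ≤ 2 * ENNReal.ofReal (r - dist y x₀) ^ n ∧
    ENNReal.ofReal (r - dist y x₀) ^ n ≤ 2 * ENNReal.ofReal (r - dist x x₀) ^ n := by
  have hn' : (1 : ℝ) ≤ n := by exact_mod_cast hn
  set d := r - dist x x₀ with hd
  have hu : 1 / (2 * (n : ℝ)) ≤ 1 / 2 := by
    apply one_div_le_one_div_of_le <;> linarith
  have hu0 : 0 < 1 / (2 * (n : ℝ)) := by positivity
  have e : d / (2 * n) = 1 / (2 * n) * d := by ring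
  rw [e] at hxy
  set ε := 1 / (2 * (n : ℝ)) with hε
  have h1 : dist y x₀ ≤ dist y x + dist x x₀ := dist_triangle _ _ _
  have h2 : dist x x₀ ≤ dist y x + dist y x₀ := dist_triangle_left _ _ _
  have h3 : ε * d ≤ 1 / 2 * d := by gcongr
  constructor
  · exact ofReal_pow_le_two_mul hn hx.le (by linarith) (by linarith)
  · refine ofReal_pow_le_two_mul hn (by linarith) hx.le ?_
    rw [← hε]
    have : (1 - ε) * (r - dist y x₀) ≤ (1 - ε) * (d + ε * d) :=
      mul_le_mul_of_nonneg_left (by linarith) (by linarith)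
    nlinarith [mul_pos (mul_pos hu0 hu0) hx]

/-- The level inequality on a single stopping cube. -/
theorem setLIntegral_ball_le_superlevel (hn : 1 ≤ n) {F G : (Fin n → ℝ) → ℝ≥0∞}
    (hF : Measurable F) (hG : Measurable G) {p r : ℝ} (hp : 1 < p) {b : ℝ≥0∞} {x₀ : Fin n → ℝ}
    (hRH : ∀ z ∈ ball x₀ r, ∀ R : ℝ, 0 < R → 4 * n * R ≤ r - dist z x₀ →
      ∫⁻ x in ball z (R / 2), F x ^ p ≤ ENNReal.ofReal R ^ n *
        (b * ((ENNReal.ofReal R ^ n)⁻¹ * ∫⁻ x in ball z R, F x)) ^ p + ∫⁻ x in ball z R, G x ^ p)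
    {t : ℝ≥0∞} {x : Fin n → ℝ} (hx : x ∈ ball x₀ r) {R : ℝ}
    (hR : 0 < R) (hRd : 8 * R ≤ (r - dist x x₀) / (2 * n))
    (hthreshold : (2 ^ n * 4 * (b + 1) * t) ^ p * volume (ball x R) <
      ENNReal.ofReal (r - dist x x₀) ^ n * ∫⁻ y in ball x R, F y ^ p)
    (hlarge : ENNReal.ofReal (r - dist x x₀) ^ n * ∫⁻ y in ball x (8 * R), F y ^ p ≤
      (2 ^ n * 4 * (b + 1) * t) ^ p * volume (ball x (8 * R))) :
    ∫⁻ y in ball x (8 * R), boundaryWeighted F p x₀ r y ^ p ≤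
      2 * 4 ^ n * (2 ^ n * 4 * (b + 1)) ^ p *
        (t ^ (p - 1) * (∫⁻ y in ball x (2 * R) ∩ {y | t < boundaryWeighted F p x₀ r y},
            boundaryWeighted F p x₀ r y)
          + ∫⁻ y in ball x (2 * R) ∩ {y | t < G y * ENNReal.ofReal r ^ (n / p)},
            (G y * ENNReal.ofReal r ^ (n / p)) ^ p) := by
  have hp0 : 0 < p := by linarith
  have hn' : (1 : ℝ) ≤ n := by exact_mod_cast hn
  set f := boundaryWeighted F p x₀ r with hf
  set g := fun y => G y * ENNReal.ofReal r ^ (n / p) with hg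
  have hfm : Measurable f := measurable_boundaryWeighted hF p x₀ r
  have hgm : Measurable g := hG.mul_const _
  have hd : 0 < r - dist x x₀ := by rw [mem_ball] at hx; linarith
  have hr : r - dist x x₀ ≤ r := by linarith [dist_nonneg (x := x) (y := x₀)]
  set w := ENNReal.ofReal (r - dist x x₀) ^ n with hw
  set N := volume (ball x R) with hN
  have hNv : N = ENNReal.ofReal (2 * R) ^ n := volume_ball_fin x hR
  have hN2 : volume (ball x (2 * R)) = 2 ^ n * N := volume_ball_two_mul x hR
  have hN8 : volume (ball x (8 * R)) = 4 ^ n * (2 ^ n * N) := by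
    rw [show 8 * R = 2 * (2 * (2 * R)) by ring, volume_ball_two_mul x (by positivity),
      volume_ball_two_mul x (by positivity), hN2, show (4 : ℝ≥0∞) = 2 * 2 by norm_num, mul_pow]
    ring
  have hw' : (ENNReal.ofReal (r - dist x x₀) ^ (n / p)) ^ p = w := by
    have := mul_rpow_div_rpow (n := n) hp0 1 (ENNReal.ofReal (r - dist x x₀))
    simpa using this
  have hcomp : ∀ y ∈ ball x (8 * R), w ≤ 2 * ENNReal.ofReal (r - dist y x₀) ^ n ∧
      ENNReal.ofReal (r - dist y x₀) ^ n ≤ 2 * w := fun y hy =>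
    weight_comparable hn hd ((mem_ball.1 hy).trans_le hRd)
  have hcomp' : ∀ y ∈ ball x (2 * R), ENNReal.ofReal (r - dist x x₀) ^ (n / p) ≤
      2 * ENNReal.ofReal (r - dist y x₀) ^ (n / p) := by
    intro y hy
    have h := (hcomp y (ball_subset_ball (by linarith) hy)).1
    rw [← ENNReal.rpow_le_rpow_iff hp0, hw']
    refine h.trans ?_
    rw [mul_rpow_div_rpow hp0]
    gcongr
    calc (2 : ℝ≥0∞) = 2 ^ (1 : ℝ) := (rpow_one _).symm
      _ ≤ 2 ^ p := rpow_le_rpow_of_exponent_le one_le_two hp.le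
  have hkey : t ^ p * (2 ^ n * N) ≤ t ^ (p - 1) * (∫⁻ y in ball x (2 * R) ∩ {y | t < f y}, f y)
          + ∫⁻ y in ball x (2 * R) ∩ {y | t < g y}, g y ^ p := by
    -- Radius 2R makes the inner cube exactly the stopping cube of radius R; admissibility holds
    -- because 16nR ≤ d(x).
    have hrh := hRH x hx (2 * R) (by positivity) (by
      have : 8 * R * (2 * n) ≤ r - dist x x₀ := (le_div_iff₀ (by positivity)).1 hRd
      nlinarith)
    rw [show 2 * R / 2 = R by ring, ← hNv] at hrh
    refine le_superlevel_of_reverse_holder hp measure_ball_lt_top.ne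
      (measure_ball_pos _ _ hR).ne' hw' hrh ?_ ?_ hthreshold
    · rw [← lintegral_const_mul _ hF, ← hN2]
      calc ∫⁻ y in ball x (2 * R), ENNReal.ofReal (r - dist x x₀) ^ (n / p) * F y
          ≤ ∫⁻ y in ball x (2 * R), 2 * f y := by
            refine setLIntegral_mono' measurableSet_ball fun y hy => ?_
            rw [hf, boundaryWeighted, mul_comm (F y), ← mul_assoc]
            gcongr
            exact hcomp' y hy
        _ = 2 * ∫⁻ y in ball x (2 * R), f y := lintegral_const_mul _ hfm
        _ ≤ _ := by
            gcongr
            exact setLIntegral_le_mul_add_superlevel hfm fun y hy => hy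
    · rw [← lintegral_const_mul _ (hG.pow_const p), ← hN2]
      calc ∫⁻ y in ball x (2 * R), w * G y ^ p ≤ ∫⁻ y in ball x (2 * R), g y ^ p := by
            refine lintegral_mono fun y => ?_
            simp only [hg]
            rw [mul_rpow_div_rpow hp0, mul_comm, hw]
            gcongr
        _ ≤ _ := setLIntegral_le_mul_add_superlevel hgm fun y hy => by gcongr
  calc ∫⁻ y in ball x (8 * R), f y ^ p ≤ ∫⁻ y in ball x (8 * R), 2 * w * F y ^ p := by
        refine setLIntegral_mono' measurableSet_ball fun y hy => ?_
        rw [hf, boundaryWeighted_rpow hp0, mul_comm]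
        gcongr
        exact (hcomp y hy).2
    _ = 2 * (w * ∫⁻ y in ball x (8 * R), F y ^ p) := by
        rw [lintegral_const_mul _ (hF.pow_const p), mul_assoc]
    _ ≤ 2 * ((2 ^ n * 4 * (b + 1) * t) ^ p * (4 ^ n * (2 ^ n * N))) := by
        rw [← hN8]; gcongr
    _ = 2 * 4 ^ n * (2 ^ n * 4 * (b + 1)) ^ p * (t ^ p * (2 ^ n * N)) := by
        rw [mul_rpow_of_nonneg (2 ^ n * 4 * (b + 1)) t hp0.le]; ring
    _ ≤ _ := by gcongr

/-- The part of the level inequality that needs the stopping cubes: above λt, almost every point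
carries such a cube, and the local estimates add up over a Vitali family. The lower bound on t
serves to stop the dyadic growth before the boundary is felt. -/
theorem level_inequality_above [NeZero n] {F G : (Fin n → ℝ) → ℝ≥0∞}
    (hF : Measurable F) (hG : Measurable G) {p r : ℝ} (hp : 1 < p) {b : ℝ≥0∞}
    {x₀ : Fin n → ℝ}
    (hRH : ∀ z ∈ ball x₀ r, ∀ R : ℝ, 0 < R → 4 * n * R ≤ r - dist z x₀ →
      ∫⁻ x in ball z (R / 2), F x ^ p ≤ ENNReal.ofReal R ^ n *
        (b * ((ENNReal.ofReal R ^ n)⁻¹ * ∫⁻ x in ball z R, F x)) ^ p + ∫⁻ x in ball z R, G x ^ p)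
    (hFp : ∫⁻ x, F x ^ p ≠ ⊤)
    {t : ℝ≥0∞} (htT : (4 * n) ^ n * ∫⁻ x, F x ^ p ≤ t ^ p) :
    ∫⁻ x in {x | 2 ^ n * 4 * (b + 1) * t < boundaryWeighted F p x₀ r x},
        boundaryWeighted F p x₀ r x ^ p ≤
      2 * 4 ^ n * (2 ^ n * 4 * (b + 1)) ^ p *
        (t ^ (p - 1) * (∫⁻ y in {y | t < boundaryWeighted F p x₀ r y}, boundaryWeighted F p x₀ r y)
          + ∫⁻ y in ball x₀ r ∩ {y | t < G y * ENNReal.ofReal r ^ (n / p)},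
            (G y * ENNReal.ofReal r ^ (n / p)) ^ p) := by
  have hp0 : 0 < p := by linarith
  have hn : 1 ≤ n := NeZero.one_le
  have hn' : (1 : ℝ) ≤ n := by exact_mod_cast hn
  set f := boundaryWeighted F p x₀ r with hf
  set g := fun y => G y * ENNReal.ofReal r ^ (n / p) with hg
  have hfm : Measurable f := measurable_boundaryWeighted hF p x₀ r
  have hgm : Measurable g := hG.mul_const _
  set C := 2 * 4 ^ n * (2 ^ n * 4 * (b + 1)) ^ p with hC
  set s := 2 ^ n * 4 * (b + 1) * t with hs
  have hts : t ≤ s := by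
    have h1 : (1 : ℝ≥0∞) ≤ 2 ^ n := one_le_pow₀ one_le_two
    have h2 : (1 : ℝ≥0∞) ≤ b + 1 := le_add_self
    calc t = 1 * 1 * 1 * t := by ring
      _ ≤ s := by rw [hs]; gcongr; norm_num
  have hEt : MeasurableSet {y | t < f y} := measurableSet_lt measurable_const hfm
  have hGt : MeasurableSet {y | t < g y} := measurableSet_lt measurable_const hgm
  set S := {x | s < f x} ∩ {x | ∀ ρ : ℝ, 0 < ρ → Tendsto (fun k : ℕ =>
    (∫⁻ y in ball x (ρ * (1 / 2) ^ k), F y ^ p) / volume (ball x (ρ * (1 / 2) ^ k)))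
      atTop (𝓝 (F x ^ p))} with hS
  have hSae : S =ᵐ[volume] {x | s < f x} := by
    have h := ae_tendsto_lintegral_ball_div_volume (hF.pow_const p) hFp
    have h' : {x | ∀ ρ : ℝ, 0 < ρ → Tendsto (fun k : ℕ =>
      (∫⁻ y in ball x (ρ * (1 / 2) ^ k), F y ^ p) / volume (ball x (ρ * (1 / 2) ^ k)))
      atTop (𝓝 (F x ^ p))} =ᵐ[volume] Set.univ := eventuallyEq_univ.2 h
    exact ((ae_eq_refl {x | s < f x}).inter h').trans (by rw [Set.inter_univ]; exact ae_eq_refl _)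
  have hpos : ∀ x ∈ S, 0 < r - dist x x₀ := by
    intro x hx
    by_contra h
    have h0 : f x = 0 := by
      have : (0 : ℝ) < n / p := by positivity
      rw [hf, boundaryWeighted, ofReal_of_nonpos (not_lt.1 h), zero_rpow_of_pos this, mul_zero]
    exact absurd hx.1 (by simp [h0])
  have hthreshold : ∀ x : Fin n → ℝ, ∃ R : ℝ, x ∈ S → 0 < R ∧ 8 * R ≤ (r - dist x x₀) / (2 * n) ∧
      s ^ p * volume (ball x R) < ENNReal.ofReal (r - dist x x₀) ^ n * ∫⁻ y in ball x R, F y ^ p ∧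
      ENNReal.ofReal (r - dist x x₀) ^ n * ∫⁻ y in ball x (8 * R), F y ^ p ≤
        s ^ p * volume (ball x (8 * R)) := by
    intro x
    by_cases hx : x ∈ S
    swap
    · exact ⟨0, fun h => absurd h hx⟩
    have hd := hpos x hx
    have hρ : 0 < (r - dist x x₀) / (2 * n) := by positivity
    obtain ⟨R, h⟩ := exists_stopping_radius (H := fun y => F y ^ p)
      (w := ENNReal.ofReal (r - dist x x₀) ^ n) (σ := s ^ p)
      (ENNReal.pow_ne_top ofReal_ne_top) hρ (hx.2 _ hρ) (by
        have h1 : s ^ p < f x ^ p := rpow_lt_rpow hx.1 hp0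
        rwa [hf, boundaryWeighted_rpow hp0, mul_comm] at h1) (by
        intro R hR
        have hR0 : 0 < R := lt_of_lt_of_le (by positivity) hR
        -- Here R ≥ ρ/4 = d/(8n), so d^n ≤ (4n)^n |Q_R|; this is the origin of the factor (4n)^n in
        -- `htT`.
        have hdR : r - dist x x₀ ≤ 4 * n * (2 * R) := by
          rw [div_div, div_le_iff₀ (by positivity)] at hR
          linarith
        calc ENNReal.ofReal (r - dist x x₀) ^ n * ∫⁻ y in ball x R, F y ^ p
            ≤ ENNReal.ofReal (4 * n * (2 * R)) ^ n * ∫⁻ y, F y ^ p := by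
              gcongr
              exact Measure.restrict_le_self
          _ = ((4 * n) ^ n * ∫⁻ y, F y ^ p) * volume (ball x R) := by
              rw [volume_ball_fin x hR0, ofReal_mul (by positivity), ofReal_mul (by norm_num),
                mul_pow]
              simp only [ofReal_natCast, ofReal_ofNat]
              ring
          _ ≤ s ^ p * volume (ball x R) := by
              gcongr
              exact htT.trans (by gcongr))
    exact ⟨R, fun _ => h⟩
  choose R hR using hthreshold
  set k : (Fin n → ℝ) → ℝ≥0∞ := fun y => C * (t ^ (p - 1) * {y | t < f y}.indicator f y
    + {y | t < g y}.indicator (fun y => g y ^ p) y) with hk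
  have hkm1 : Measurable ({y | t < f y}.indicator f) := hfm.indicator hEt
  have hkm2 : Measurable ({y | t < g y}.indicator fun y => g y ^ p) :=
    (hgm.pow_const p).indicator hGt
  have hkint : ∀ A : Set (Fin n → ℝ), MeasurableSet A → ∫⁻ y in A, k y =
      C * (t ^ (p - 1) * (∫⁻ y in A ∩ {y | t < f y}, f y)
        + ∫⁻ y in A ∩ {y | t < g y}, g y ^ p) := by
    intro A hA
    simp only [hk]
    rw [lintegral_const_mul _ (by exact (hkm1.const_mul _).add hkm2),
      lintegral_add_left (hkm1.const_mul _), lintegral_const_mul _ hkm1, lintegral_indicator hEt,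
      lintegral_indicator hGt, Measure.restrict_restrict hEt, Measure.restrict_restrict hGt,
      Set.inter_comm, Set.inter_comm {y | t < g y}]
  -- The majorant is cut off to the cube because g, unlike f, carries no weight vanishing outside;
  -- every Q_{2R}(x) stays inside it.
  have hV := setLIntegral_le_of_vitali (S := S) (R := R) (M := r) (h := fun y => f y ^ p)
    (k := (ball x₀ r).indicator k) (fun x hx => (hR x hx).1) (fun x hx => by
      obtain ⟨h1, h2, -⟩ := hR x hx
      have h3 : (r - dist x x₀) / (2 * n) ≤ r - dist x x₀ :=
        div_le_self (hpos x hx).le (by linarith)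
      linarith [dist_nonneg (x := x) (y := x₀)]) (fun x hx => by
      obtain ⟨h1, h2, h3, h4⟩ := hR x hx
      have hxQ : x ∈ ball x₀ r := by rw [mem_ball]; linarith [hpos x hx]
      have hsub : ball x (2 * R x) ⊆ ball x₀ r := by
        refine ball_subset_ball' ?_
        have h5 : (r - dist x x₀) / (2 * n) ≤ r - dist x x₀ :=
          div_le_self (hpos x hx).le (by linarith)
        linarith
      rw [setLIntegral_indicator measurableSet_ball, Set.inter_eq_right.2 hsub,
        hkint _ measurableSet_ball]
      exact setLIntegral_ball_le_superlevel hn hF hG hp hRH hxQ h1 h2 h3 h4)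
  rw [← setLIntegral_congr hSae]
  refine hV.trans ?_
  rw [lintegral_indicator measurableSet_ball, hkint _ measurableSet_ball]
  gcongr
  exact Set.inter_subset_right

/-- Gehring's level inequality for the boundary weighted functions. -/
theorem level_inequality [NeZero n] {F G : (Fin n → ℝ) → ℝ≥0∞}
    (hF : Measurable F) (hG : Measurable G) {p r : ℝ} (hp : 1 < p) {b : ℝ≥0∞}
    {x₀ : Fin n → ℝ}
    (hRH : ∀ z ∈ ball x₀ r, ∀ R : ℝ, 0 < R → 4 * n * R ≤ r - dist z x₀ →
      ∫⁻ x in ball z (R / 2), F x ^ p ≤ ENNReal.ofReal R ^ n *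
        (b * ((ENNReal.ofReal R ^ n)⁻¹ * ∫⁻ x in ball z R, F x)) ^ p + ∫⁻ x in ball z R, G x ^ p)
    (hFp : ∫⁻ x, F x ^ p ≠ ⊤)
    {t : ℝ≥0∞} (htT : (4 * n) ^ n * ∫⁻ x, F x ^ p ≤ t ^ p) :
    ∫⁻ x in {x | t < boundaryWeighted F p x₀ r x}, boundaryWeighted F p x₀ r x ^ p ≤
      (2 * 4 ^ n + 1) * (2 ^ n * 4 * (b + 1)) ^ p *
        (t ^ (p - 1) * (∫⁻ y in {y | t < boundaryWeighted F p x₀ r y}, boundaryWeighted F p x₀ r y)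
          + ∫⁻ y in ball x₀ r ∩ {y | t < G y * ENNReal.ofReal r ^ (n / p)},
            (G y * ENNReal.ofReal r ^ (n / p)) ^ p) := by
  have hp0 : 0 < p := by linarith
  have h1 := level_inequality_above hF hG hp hRH hFp htT
  have hfm : Measurable (boundaryWeighted F p x₀ r) := measurable_boundaryWeighted hF p x₀ r
  set f := boundaryWeighted F p x₀ r with hf
  set l := 2 ^ n * 4 * (b + 1) with hl
  have hl1 : 1 ≤ l := by
    have h1 : (1 : ℝ≥0∞) ≤ 2 ^ n := one_le_pow₀ one_le_two
    have h2 : (1 : ℝ≥0∞) ≤ b + 1 := le_add_self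
    calc (1 : ℝ≥0∞) = 1 * 1 * 1 := by ring
      _ ≤ l := by rw [hl]; gcongr; norm_num
  have hE : MeasurableSet {x | l * t < f x} := measurableSet_lt measurable_const hfm
  have hsub : {x | l * t < f x} ⊆ {x | t < f x} := fun x hx =>
    (le_mul_of_one_le_left (zero_le) hl1).trans_lt hx
  -- On this band f^p ≤ (λt)^{p-1} f, which accounts for the `+ 1` in the constant.
  have h2 : ∫⁻ x in {x | t < f x} \ {x | l * t < f x}, f x ^ p ≤
      l ^ p * (t ^ (p - 1) * ∫⁻ x in {x | t < f x}, f x) := by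
    have hEt : MeasurableSet {y | t < f y} := measurableSet_lt measurable_const hfm
    calc ∫⁻ x in {x | t < f x} \ {x | l * t < f x}, f x ^ p
        ≤ ∫⁻ x in {x | t < f x} \ {x | l * t < f x}, l ^ p * t ^ (p - 1) * f x := by
          refine setLIntegral_mono' (hEt.diff hE) fun x hx => ?_
          have hx2 : f x ≤ l * t := not_lt.1 hx.2
          have hfp : f x ^ p = f x ^ (p - 1) * f x := by
            conv_lhs => rw [show p = (p - 1) + 1 by ring,
              rpow_add_of_nonneg _ _ (by linarith) zero_le_one, rpow_one]
          rw [hfp]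
          gcongr
          calc f x ^ (p - 1) ≤ (l * t) ^ (p - 1) := rpow_le_rpow hx2 (by linarith)
            _ = l ^ (p - 1) * t ^ (p - 1) := mul_rpow_of_nonneg _ _ (by linarith)
            _ ≤ l ^ p * t ^ (p - 1) := by
              gcongr 1
              exact rpow_le_rpow_of_exponent_le hl1 (by linarith)
      _ ≤ ∫⁻ x in {x | t < f x}, l ^ p * t ^ (p - 1) * f x :=
          lintegral_mono_set Set.sdiff_subset
      _ = _ := by rw [lintegral_const_mul _ hfm, mul_assoc]
  rw [← lintegral_inter_add_sdiff (fun x => f x ^ p) {x | t < f x} hE, Set.inter_eq_right.2 hsub]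
  refine (add_le_add h1 h2).trans ?_
  rw [add_mul, add_mul, one_mul]
  gcongr
  exact le_self_add

end LevelInequality

/-! ### Comparison of the level constant with ϰ. -/

section Constants

theorem two_mul_level_constant_le_varkappa {n : ℕ} (hn : 2 ≤ n) {p B : ℝ} (hp : 1 < p)
    (hB : 0 < B) :
    2 * ((2 * 4 ^ n + 1) * (2 ^ n * 4 * (B ^ (1 / p) + 1)) ^ p) ≤ varkappa n p B := by
  have hb : 0 < B ^ (1 / p) + 1 := by positivity
  have h8 : (2 : ℝ) ^ (3 * n * p) = ((8 : ℝ) ^ n) ^ p := by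
    rw [Real.rpow_mul (by norm_num), show (3 * (n : ℝ)) = ((3 * n : ℕ) : ℝ) by push_cast; ring,
      Real.rpow_natCast, pow_mul]
    norm_num
  have h4 : (16 : ℝ) ≤ 4 ^ n := by
    calc (16 : ℝ) = 4 ^ 2 := by norm_num
      _ ≤ 4 ^ n := pow_le_pow_right₀ (by norm_num) hn
  have h84 : (8 : ℝ) ^ n = 4 ^ n * 2 ^ n := by rw [← mul_pow]; norm_num
  have h2 : (0 : ℝ) < 2 ^ n := by positivity
  -- Amounts to 2^{n+4} ≤ 8^n, which is where n ≥ 2 is needed.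
  have h1 : 4 * (2 ^ n * 4 : ℝ) ^ p ≤ ((8 : ℝ) ^ n) ^ p := by
    calc 4 * (2 ^ n * 4 : ℝ) ^ p ≤ (4 : ℝ) ^ p * (2 ^ n * 4 : ℝ) ^ p := by
          gcongr
          calc (4 : ℝ) = 4 ^ (1 : ℝ) := (Real.rpow_one _).symm
            _ ≤ 4 ^ p := Real.rpow_le_rpow_of_exponent_le (by norm_num) hp.le
      _ = (4 * (2 ^ n * 4)) ^ p := (Real.mul_rpow (by norm_num) (by positivity)).symm
      _ ≤ ((8 : ℝ) ^ n) ^ p := by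
          gcongr
          rw [h84]; nlinarith
  have h3 : 2 * (2 * (4 : ℝ) ^ n + 1) ≤ (8 ^ n + 1) * 4 := by
    have : (4 : ℝ) ^ n ≤ 8 ^ n := by gcongr; norm_num
    linarith
  rw [varkappa, h8, Real.mul_rpow (by positivity) hb.le]
  have hbp : 0 < (B ^ (1 / p) + 1) ^ p := by positivity
  have hcp : 0 < (2 ^ n * 4 : ℝ) ^ p := by positivity
  calc 2 * ((2 * 4 ^ n + 1) * ((2 ^ n * 4 : ℝ) ^ p * (B ^ (1 / p) + 1) ^ p))
      = (2 * (2 * (4 : ℝ) ^ n + 1)) * (2 ^ n * 4 : ℝ) ^ p * (B ^ (1 / p) + 1) ^ p := by ring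
    _ ≤ ((8 ^ n + 1) * 4) * (2 ^ n * 4 : ℝ) ^ p * (B ^ (1 / p) + 1) ^ p := by gcongr
    _ = (8 ^ n + 1) * (4 * (2 ^ n * 4 : ℝ) ^ p) * (B ^ (1 / p) + 1) ^ p := by ring
    _ ≤ _ := by gcongr

theorem one_le_level_constant {n : ℕ} {p B : ℝ} (hp : 1 < p) (hB : 0 < B) :
    1 ≤ (2 * 4 ^ n + 1) * (2 ^ n * 4 * (B ^ (1 / p) + 1)) ^ p := by
  have hb : 0 < B ^ (1 / p) := by positivity
  have h2 : (1 : ℝ) ≤ 2 ^ n := one_le_pow₀ one_le_two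
  have h4 : (0 : ℝ) < 4 ^ n := by positivity
  refine one_le_mul_of_one_le_of_one_le (by linarith) (Real.one_le_rpow ?_ (by linarith))
  exact one_le_mul_of_one_le_of_one_le (by linarith) (by linarith)

theorem eight_mul_sq_add_one_le_varkappa {n : ℕ} {p B : ℝ} (hp : 1 < p) (hB : 0 < B) :
    8 * (n : ℝ) ^ 2 + 1 ≤ varkappa n p B := by
  have h8 : (2 : ℝ) ^ (3 * n * p) = ((8 : ℝ) ^ n) ^ p := by
    rw [Real.rpow_mul (by norm_num), show (3 * (n : ℝ)) = ((3 * n : ℕ) : ℝ) by push_cast; ring,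
      Real.rpow_natCast, pow_mul]
    norm_num
  have hb1 : 1 ≤ (B ^ (1 / p) + 1) ^ p := by
    have : 0 < B ^ (1 / p) := by positivity
    exact Real.one_le_rpow (by linarith) (by linarith)
  have hbern := one_add_mul_le_pow (a := (7 : ℝ)) (by norm_num) n
  norm_num at hbern
  have h1 : (1 : ℝ) ≤ 8 ^ n := one_le_pow₀ (by norm_num)
  have h2 : (8 : ℝ) ^ n ≤ ((8 : ℝ) ^ n) ^ p := by
    calc (8 : ℝ) ^ n = ((8 : ℝ) ^ n) ^ (1 : ℝ) := (Real.rpow_one _).symm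
      _ ≤ _ := Real.rpow_le_rpow_of_exponent_le h1 hp.le
  have hn0 : (0 : ℝ) ≤ n := Nat.cast_nonneg n
  rw [varkappa, h8]
  calc 8 * (n : ℝ) ^ 2 + 1 ≤ (8 ^ n + 1) * 8 ^ n * 1 := by nlinarith
    _ ≤ _ := by gcongr

/-- The loss from starting the level integration at a high level is absorbed by the gap between
the two constants. -/
theorem rpow_mul_sub_le {n : ℕ} (hn : 2 ≤ n) {p c k K : ℝ} (hp : 1 < p) (hc : 0 < c)
    (hk : 8 * (n : ℝ) ^ 2 + 1 ≤ k) (hK : 2 * K ≤ k) (hK1 : 1 ≤ K)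
    (hck : c < (p - 1) / (k - 1)) :
    (4 * n : ℝ) ^ (n * c / p) * (p - 1 - (k - 1) * c) ≤ p - 1 - (K - 1) * c := by
  have hn' : (2 : ℝ) ≤ n := by exact_mod_cast hn
  have hk1 : 0 < k - 1 := by nlinarith
  have hp0 : 0 < p := by linarith
  rw [lt_div_iff₀ hk1] at hck
  set m := Real.log (4 * n) * (n / p) with hm
  have hlog : Real.log (4 * n) ≤ 4 * n :=
    (Real.log_le_sub_one_of_pos (by linarith)).trans (by linarith)
  have hlog0 : 0 ≤ Real.log (4 * n) := Real.log_nonneg (by linarith)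
  have hm0 : 0 ≤ m := by positivity
  -- The factor to be absorbed is exp(mc). From log(4n) ≤ 4n one gets m(p-1) ≤ 4n², so half of k-1
  -- pays for it, while 2K ≤ k leaves the other half for K-1. The conclusion then follows from
  -- exp(mc)(1 - mc) ≤ 1.
  have hma : m * (p - 1) ≤ (k - 1) / 2 := by
    have h1 : m * (p - 1) = Real.log (4 * n) * n * ((p - 1) / p) := by rw [hm]; ring
    have h2 : (p - 1) / p ≤ 1 := (div_le_one hp0).2 (by linarith)
    have h3 : 0 ≤ (p - 1) / p := div_nonneg (by linarith) hp0.le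
    have h4 : Real.log (4 * n) * n * ((p - 1) / p) ≤ 4 * n * n * 1 := by gcongr
    rw [h1]
    nlinarith
  have hM : (4 * n : ℝ) ^ (n * c / p) = Real.exp (m * c) := by
    rw [Real.rpow_def_of_pos (by linarith), hm]; congr 1; ring
  rw [hM]
  have hexp : Real.exp (m * c) * (1 - m * c) ≤ 1 := by
    have := Real.add_one_le_exp (-(m * c))
    calc Real.exp (m * c) * (1 - m * c) ≤ Real.exp (m * c) * Real.exp (-(m * c)) := by
          gcongr; linarith
      _ = 1 := by rw [← Real.exp_add]; simp
  have hmc : m * c * (p - 1) ≤ (k - 1) / 2 * c := by nlinarith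
  have hnn : 0 ≤ p - 1 - (K - 1) * c := by nlinarith
  have hmain : p - 1 - (k - 1) * c ≤ (1 - m * c) * (p - 1 - (K - 1) * c) := by
    have : 0 ≤ m * c * ((K - 1) * c) := by
      have := sub_nonneg.2 hK1
      positivity
    nlinarith
  calc Real.exp (m * c) * (p - 1 - (k - 1) * c)
      ≤ Real.exp (m * c) * ((1 - m * c) * (p - 1 - (K - 1) * c)) := by gcongr
    _ = (Real.exp (m * c) * (1 - m * c)) * (p - 1 - (K - 1) * c) := by ring
    _ ≤ 1 * (p - 1 - (K - 1) * c) := by gcongr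
    _ = _ := one_mul _

end Constants

/-! ### Higher integrability on one cube, in the sup norm. -/

section CubeEstimate
open ENNReal Filter Topology Metric

variable {n : ℕ}

theorem setLIntegral_superlevel_boundaryWeighted (F : (Fin n → ℝ) → ℝ≥0∞) {p : ℝ}
    (hnp : 0 < (n : ℝ) / p) (hF : Measurable F) (x₀ : Fin n → ℝ) (r : ℝ) (t : ℝ≥0∞)
    (h : (Fin n → ℝ) → ℝ≥0∞) :
    ∫⁻ x in {x | t < boundaryWeighted F p x₀ r x}, h x ∂(volume.restrict (ball x₀ r)) =
      ∫⁻ x in {x | t < boundaryWeighted F p x₀ r x}, h x := by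
  have hE : MeasurableSet {x | t < boundaryWeighted F p x₀ r x} :=
    measurableSet_lt measurable_const (measurable_boundaryWeighted hF p x₀ r)
  rw [Measure.restrict_restrict hE, Set.inter_eq_left.2]
  intro x hx
  by_contra hxb
  have : boundaryWeighted F p x₀ r x = 0 := by
    rw [mem_ball, not_lt] at hxb
    rw [boundaryWeighted, ofReal_of_nonpos (by linarith), zero_rpow_of_pos hnp, mul_zero]
  simp [this] at hx

/-- Higher integrability on a cube, in the sup-norm model. -/
theorem higher_integrability_cube (hn : 2 ≤ n) {F G : (Fin n → ℝ) → ℝ≥0∞}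
    (hF : Measurable F) (hG : Measurable G) {p q r B : ℝ} (hp : 1 < p) (hB : 0 < B)
    (hpq : p < q) (hq : q < p + (p - 1) / (varkappa n p B - 1)) {x₀ : Fin n → ℝ}
    (hRH : ∀ z ∈ ball x₀ r, ∀ R : ℝ, 0 < R → 4 * n * R ≤ r - dist z x₀ →
      ∫⁻ x in ball z (R / 2), F x ^ p ≤ ENNReal.ofReal R ^ n *
        (ENNReal.ofReal (B ^ (1 / p)) * ((ENNReal.ofReal R ^ n)⁻¹ * ∫⁻ x in ball z R, F x)) ^ p
          + ∫⁻ x in ball z R, G x ^ p)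
    (hFp : ∫⁻ x, F x ^ p ≠ ⊤)
    (hGq : ∫⁻ x in ball x₀ r, (G x * ENNReal.ofReal r ^ (n / p)) ^ q ≠ ⊤) :
    ∫⁻ x in ball x₀ r, boundaryWeighted F p x₀ r x ^ q ≠ ⊤ ∧
    (q - 1 - varkappa n p B * (q - p)) *
        (∫⁻ x in ball x₀ r, boundaryWeighted F p x₀ r x ^ q).toReal ≤
      (p - 1) * (∫⁻ x, F x ^ p).toReal ^ ((q - p) / p) *
          (∫⁻ x in ball x₀ r, boundaryWeighted F p x₀ r x ^ p).toReal
        + varkappa n p B * (q - 1) *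
          (∫⁻ x in ball x₀ r, (G x * ENNReal.ofReal r ^ (n / p)) ^ q).toReal := by
  have hp0 : 0 < p := by linarith
  have hn' : (2 : ℝ) ≤ n := by exact_mod_cast hn
  have : NeZero n := ⟨by omega⟩
  have hnp : 0 < (n : ℝ) / p := by positivity
  have hκ := eight_mul_sq_add_one_le_varkappa (n := n) hp hB
  have hKκ := two_mul_level_constant_le_varkappa hn hp hB
  have hK1 := one_le_level_constant (n := n) hp hB
  set K := (2 * 4 ^ n + 1) * (2 ^ n * 4 * (B ^ (1 / p) + 1)) ^ p with hK
  set k := varkappa n p B with hk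
  set T := ∫⁻ x, F x ^ p with hT
  have hp1 : 0 ≤ p - 1 := by linarith
  have hq1 : 0 ≤ q - 1 := by linarith
  have hk0 : 0 ≤ k := by linarith
  -- The starting level τ must be positive, so F = 0 almost everywhere is treated apart.
  rcases eq_or_ne T 0 with hT0 | hT0
  · have hF0 : F =ᵐ[volume] 0 := by
      filter_upwards [(lintegral_eq_zero_iff (hF.pow_const p)).1 hT0] with x hx
      simpa [hp0, hp0.le, not_lt.2 hp0.le] using hx
    have hI : ∫⁻ x in ball x₀ r, boundaryWeighted F p x₀ r x ^ q = 0 := by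
      rw [lintegral_eq_zero_iff ((measurable_boundaryWeighted hF p x₀ r).pow_const q)]
      filter_upwards [ae_restrict_of_ae hF0] with x hx
      simp only [Pi.zero_apply] at hx ⊢
      rw [boundaryWeighted, hx, zero_mul, zero_rpow_of_pos (by linarith)]
    rw [hI]
    refine ⟨zero_ne_top, ?_⟩
    rw [toReal_zero, mul_zero]
    positivity
  have hc : 0 < q - p := sub_pos.2 hpq
  have hTr : 0 < T.toReal := toReal_pos hT0 hFp
  have hloss := rpow_mul_sub_le hn hp hc hκ hKκ hK1 (by linarith)
  have hcK : (k - 1) * (q - p) < p - 1 := by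
    rw [mul_comm, ← lt_div_iff₀ (by nlinarith)]; linarith
  -- The smallest level at which `level_inequality` is available.
  set τ := ((4 * n : ℝ) ^ n * T.toReal) ^ (1 / p) with hτ
  have hτ0 : 0 < τ := by positivity
  have hτp : ENNReal.ofReal τ ^ p = (4 * n) ^ n * T := by
    rw [ofReal_rpow_of_pos hτ0, hτ, ← Real.rpow_mul (by positivity), one_div_mul_cancel hp0.ne',
      Real.rpow_one, ofReal_mul (by positivity), ofReal_toReal hFp, ofReal_pow (by positivity),
      ofReal_mul (by norm_num)]
    simp
  have hKo : ENNReal.ofReal K =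
      (2 * 4 ^ n + 1) * (2 ^ n * 4 * (ENNReal.ofReal (B ^ (1 / p)) + 1)) ^ p := by
    have hb : 0 ≤ B ^ (1 / p) := by positivity
    rw [hK, ofReal_mul (by positivity), ← ofReal_rpow_of_nonneg (by positivity) hp0.le,
      ofReal_mul (by positivity), ofReal_add hb zero_le_one, ofReal_add (by positivity) zero_le_one,
      ofReal_mul (by positivity), ofReal_mul (by positivity), ofReal_pow (by norm_num),
      ofReal_pow (by norm_num)]
    simp
  have hIp : ∫⁻ x in ball x₀ r, boundaryWeighted F p x₀ r x ^ p ≠ ⊤ := by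
    have : ∫⁻ x in ball x₀ r, boundaryWeighted F p x₀ r x ^ p ≤ T * ENNReal.ofReal r ^ n := by
      rw [hT, ← lintegral_mul_const _ (hF.pow_const p)]
      refine (setLIntegral_le_lintegral _ _).trans (lintegral_mono fun x => ?_)
      rw [boundaryWeighted_rpow hp0]
      gcongr
      linarith [dist_nonneg (x := x) (y := x₀)]
    exact ne_top_of_le_ne_top (mul_ne_top hFp (ENNReal.pow_ne_top ofReal_ne_top)) this
  obtain ⟨hfin, hmain⟩ := gehring_lintegral (μ := volume.restrict (ball x₀ r))
    (measurable_boundaryWeighted hF p x₀ r) (hG.mul_const (ENNReal.ofReal r ^ (n / p)))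
    hp hpq hτ0 hK1 (by nlinarith) hIp hGq (by
      intro t hτt
      have hGt : MeasurableSet {x | ENNReal.ofReal t < G x * ENNReal.ofReal r ^ (n / p)} :=
        measurableSet_lt measurable_const (hG.mul_const _)
      rw [setLIntegral_superlevel_boundaryWeighted F hnp hF,
        setLIntegral_superlevel_boundaryWeighted F hnp hF, Measure.restrict_restrict hGt,
        Set.inter_comm {x | ENNReal.ofReal t < G x * ENNReal.ofReal r ^ (n / p)}, hKo]
      refine level_inequality hF hG hp hRH hFp ?_
      rw [← hτp]
      gcongr)
  refine ⟨hfin, ?_⟩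
  set I := (∫⁻ x in ball x₀ r, boundaryWeighted F p x₀ r x ^ q).toReal with hI
  set P := (∫⁻ x in ball x₀ r, boundaryWeighted F p x₀ r x ^ p).toReal with hP
  set W := (∫⁻ x in ball x₀ r, (G x * ENNReal.ofReal r ^ (n / p)) ^ q).toReal with hW
  have hI0 : 0 ≤ I := toReal_nonneg
  have hW0 : 0 ≤ W := toReal_nonneg
  set M := (4 * n : ℝ) ^ (n * (q - p) / p) with hM
  have hM1 : 1 ≤ M := Real.one_le_rpow (by linarith) (by positivity)
  have hτc : τ ^ (q - p) = M * T.toReal ^ ((q - p) / p) := by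
    rw [hτ, ← Real.rpow_mul (by positivity), Real.mul_rpow (by positivity) hTr.le,
      ← Real.rpow_natCast, ← Real.rpow_mul (by positivity), hM]
    congr 2 <;> ring
  rw [hτc] at hmain
  have e1 : q - 1 - k * (q - p) = p - 1 - (k - 1) * (q - p) := by ring
  have e2 : q - 1 - K * (q - p) = p - 1 - (K - 1) * (q - p) := by ring
  rw [e2] at hmain
  rw [e1]
  have hM0 : 0 < M := by linarith
  -- Multiplying by the loss M lets `hloss` trade kM-terms for K-terms; M ≥ 1 and K ≤ k take care of
  -- the g-term.
  refine le_of_mul_le_mul_left ?_ hM0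
  calc M * ((p - 1 - (k - 1) * (q - p)) * I) = M * (p - 1 - (k - 1) * (q - p)) * I := by ring
    _ ≤ (p - 1 - (K - 1) * (q - p)) * I := by gcongr
    _ ≤ (p - 1) * (M * T.toReal ^ ((q - p) / p)) * P + K * (q - 1) * W := hmain
    _ ≤ (p - 1) * (M * T.toReal ^ ((q - p) / p)) * P + M * (k * (q - 1) * W) := by
        refine add_le_add le_rfl ?_
        calc K * (q - 1) * W ≤ k * (q - 1) * W := by gcongr; linarith
          _ ≤ M * (k * (q - 1) * W) := le_mul_of_one_le_left (by positivity) hM1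
    _ = _ := by ring

/-- Higher integrability on a subset of a cube that stays away from the boundary of the cube. -/
theorem higher_integrability_subset (hn : 2 ≤ n) {F G : (Fin n → ℝ) → ℝ≥0∞}
    (hF : Measurable F) (hG : Measurable G) {p q r B c : ℝ} (hp : 1 < p) (hB : 0 < B)
    (hpq : p ≤ q) (hq : q < p + (p - 1) / (varkappa n p B - 1)) {x₀ : Fin n → ℝ}
    (hRH : ∀ z ∈ ball x₀ r, ∀ R : ℝ, 0 < R → 4 * n * R ≤ r - dist z x₀ →
      ∫⁻ x in ball z (R / 2), F x ^ p ≤ ENNReal.ofReal R ^ n *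
        (ENNReal.ofReal (B ^ (1 / p)) * ((ENNReal.ofReal R ^ n)⁻¹ * ∫⁻ x in ball z R, F x)) ^ p
          + ∫⁻ x in ball z R, G x ^ p)
    (hFp : ∫⁻ x, F x ^ p ≠ ⊤) (hGq : ∫⁻ x in ball x₀ r, G x ^ q ≠ ⊤)
    (hr : 0 < r) (hc : 0 < c) {A : Set (Fin n → ℝ)} (hA : MeasurableSet A)
    (hcA : ∀ x ∈ A, c ≤ r - dist x x₀) :
    ∫⁻ x in A, F x ^ q ≠ ⊤ ∧
    c ^ (n * q / p) * ((q - 1 - varkappa n p B * (q - p)) * (∫⁻ x in A, F x ^ q).toReal) ≤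
      (p - 1) * r ^ n * (∫⁻ x, F x ^ p).toReal ^ (q / p)
        + varkappa n p B * (q - 1) * r ^ (n * q / p) * (∫⁻ x in ball x₀ r, G x ^ q).toReal := by
  have hp0 : 0 < p := by linarith
  have hq0 : 0 < q := by linarith
  have hn' : (2 : ℝ) ≤ n := by exact_mod_cast hn
  have hκ := eight_mul_sq_add_one_le_varkappa (n := n) hp hB
  have hk0 : 0 ≤ varkappa n p B := by nlinarith
  have hp1 : 0 ≤ p - 1 := by linarith
  have hq1 : 0 ≤ q - 1 := by linarith
  have hD : 0 < q - 1 - varkappa n p B * (q - p) := by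
    have : (q - p) < (p - 1) / (varkappa n p B - 1) := by linarith
    rw [lt_div_iff₀ (by nlinarith)] at this
    linarith
  have hAsub : A ⊆ ball x₀ r := fun x hx => by rw [mem_ball]; linarith [hcA x hx]
  -- For q = p no gain is claimed and c ≤ r suffices; the integration over levels requires q > p.
  rcases hpq.eq_or_lt with rfl | hpq
  · have hAp : ∫⁻ x in A, F x ^ p ≤ ∫⁻ x, F x ^ p := setLIntegral_le_lintegral _ _
    refine ⟨ne_top_of_le_ne_top hFp hAp, ?_⟩
    rcases A.eq_empty_or_nonempty with rfl | ⟨x, hx⟩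
    · simp only [Measure.restrict_empty, lintegral_zero_measure, toReal_zero, mul_zero]
      positivity
    have hcr : c ≤ r := by linarith [hcA x hx, dist_nonneg (x := x) (y := x₀)]
    have e1 : (n : ℝ) * p / p = n := by field_simp
    rw [e1, div_self hp0.ne', Real.rpow_one, Real.rpow_natCast, Real.rpow_natCast, sub_self,
      mul_zero, sub_zero]
    have h1 := toReal_mono hFp hAp
    have h2 : c ^ n ≤ r ^ n := by gcongr
    calc c ^ n * ((p - 1) * (∫⁻ x in A, F x ^ p).toReal)
        ≤ r ^ n * ((p - 1) * (∫⁻ x, F x ^ p).toReal) := by gcongr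
      _ = (p - 1) * r ^ n * (∫⁻ x, F x ^ p).toReal := by ring
      _ ≤ _ := le_add_of_nonneg_right (by positivity)
  have hmulq : ∀ a d : ℝ≥0∞, (a * d ^ (n / p)) ^ q = d ^ (n * q / p) * a ^ q := fun a d => by
    rw [mul_rpow_of_nonneg _ _ hq0.le, ← rpow_mul, mul_comm]; congr 2; ring
  have hnq : 0 ≤ n * q / p := by positivity
  have hGr : ∫⁻ x in ball x₀ r, (G x * ENNReal.ofReal r ^ (n / p)) ^ q =
      ENNReal.ofReal (r ^ (n * q / p)) * ∫⁻ x in ball x₀ r, G x ^ q := by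
    simp_rw [hmulq]
    rw [lintegral_const_mul _ (hG.pow_const q), ofReal_rpow_of_pos hr]
  obtain ⟨hfin, hmain⟩ := higher_integrability_cube hn hF hG hp hB hpq hq hRH hFp
    (by rw [hGr]; exact mul_ne_top ofReal_ne_top hGq)
  rw [hGr, toReal_mul, toReal_ofReal (by positivity)] at hmain
  have hAle : ENNReal.ofReal (c ^ (n * q / p)) * ∫⁻ x in A, F x ^ q ≤
      ∫⁻ x in ball x₀ r, boundaryWeighted F p x₀ r x ^ q := by
    rw [← lintegral_const_mul _ (hF.pow_const q), ← ofReal_rpow_of_pos hc]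
    refine (setLIntegral_mono' hA fun x hx => ?_).trans (lintegral_mono_set hAsub)
    rw [boundaryWeighted, hmulq]
    gcongr
    exact hcA x hx
  have hcpos : 0 < c ^ (n * q / p) := by positivity
  have hAtop : ∫⁻ x in A, F x ^ q ≠ ⊤ := by
    intro h
    rw [h, mul_top (ofReal_pos.2 hcpos).ne', top_le_iff] at hAle
    exact hfin hAle
  have hAr := toReal_mono hfin hAle
  rw [toReal_mul, toReal_ofReal hcpos.le] at hAr
  have hPle : (∫⁻ x in ball x₀ r, boundaryWeighted F p x₀ r x ^ p).toReal ≤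
      (∫⁻ x, F x ^ p).toReal * r ^ n := by
    have : ∫⁻ x in ball x₀ r, boundaryWeighted F p x₀ r x ^ p ≤
        (∫⁻ x, F x ^ p) * ENNReal.ofReal r ^ n := by
      rw [← lintegral_mul_const _ (hF.pow_const p)]
      refine (setLIntegral_le_lintegral _ _).trans (lintegral_mono fun x => ?_)
      rw [boundaryWeighted_rpow hp0]
      gcongr
      linarith [dist_nonneg (x := x) (y := x₀)]
    have h := toReal_mono (mul_ne_top hFp (ENNReal.pow_ne_top ofReal_ne_top)) this
    rwa [toReal_mul, toReal_pow, toReal_ofReal hr.le] at h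
  refine ⟨hAtop, ?_⟩
  set T := (∫⁻ x, F x ^ p).toReal
  have hT0 : 0 ≤ T := toReal_nonneg
  have hTq : T ^ (q / p) = T ^ ((q - p) / p) * T := by
    have e : q / p = (q - p) / p + 1 := by field_simp; ring
    rw [e, Real.rpow_add_of_nonneg hT0 (div_nonneg (by linarith) hp0.le) zero_le_one, Real.rpow_one]
  calc c ^ (n * q / p) * ((q - 1 - varkappa n p B * (q - p)) * (∫⁻ x in A, F x ^ q).toReal)
      = (q - 1 - varkappa n p B * (q - p)) * (c ^ (n * q / p) * (∫⁻ x in A, F x ^ q).toReal) := by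
        ring
    _ ≤ (q - 1 - varkappa n p B * (q - p)) *
        (∫⁻ x in ball x₀ r, boundaryWeighted F p x₀ r x ^ q).toReal := by gcongr
    _ ≤ _ := hmain
    _ ≤ (p - 1) * T ^ ((q - p) / p) * (T * r ^ n) + varkappa n p B * (q - 1) *
          (r ^ (n * q / p) * (∫⁻ x in ball x₀ r, G x ^ q).toReal) := by gcongr
    _ = _ := by rw [hTq]; ring

end CubeEstimate

/-! ### Cubes in Euclidean space and their boundary distance. -/

section EuclideanCubes
open ENNReal Filter Topology Metric

variable {n : ℕ}

theorem mem_cubicInterval_iff {x y : EuclideanSpace ℝ (Fin n)} {R : ℝ} (hR : 0 < R) :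
    y ∈ cubicInterval x R ↔ dist y.ofLp x.ofLp < R := by
  rw [dist_pi_lt_iff hR]
  rfl

theorem cubicInterval_eq_preimage_ball (x : EuclideanSpace ℝ (Fin n)) {R : ℝ} (hR : 0 < R) :
    cubicInterval x R = PiLp.homeomorph 2 (fun _ : Fin n => ℝ) ⁻¹' ball x.ofLp R := by
  ext y
  exact mem_cubicInterval_iff hR

theorem isOpen_cubicInterval (x : EuclideanSpace ℝ (Fin n)) {R : ℝ} (hR : 0 < R) :
    IsOpen (cubicInterval x R) := by
  rw [cubicInterval_eq_preimage_ball x hR]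
  exact isOpen_ball.preimage (Homeomorph.continuous _)

theorem mem_frontier_cubicInterval_iff {x y : EuclideanSpace ℝ (Fin n)} {R : ℝ} (hR : 0 < R) :
    y ∈ frontier (cubicInterval x R) ↔ dist y.ofLp x.ofLp = R := by
  rw [cubicInterval_eq_preimage_ball x hR, ← Homeomorph.preimage_frontier, frontier_ball _ hR.ne']
  rfl

theorem toLp_preimage_cubicInterval (x : EuclideanSpace ℝ (Fin n)) {R : ℝ} (hR : 0 < R) :
    WithLp.toLp 2 ⁻¹' cubicInterval x R = ball x.ofLp R := by
  ext y
  exact mem_cubicInterval_iff hR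

theorem setLIntegral_toLp_preimage (A : Set (EuclideanSpace ℝ (Fin n)))
    (h : EuclideanSpace ℝ (Fin n) → ℝ≥0∞) :
    ∫⁻ y in WithLp.toLp 2 ⁻¹' A, h (WithLp.toLp 2 y) = ∫⁻ x in A, h x :=
  (PiLp.volume_preserving_toLp (Fin n)).setLIntegral_comp_preimage_emb
    (MeasurableEquiv.toLp 2 (Fin n → ℝ)).measurableEmbedding h A

theorem setLIntegral_ball_toLp (x : EuclideanSpace ℝ (Fin n)) {R : ℝ} (hR : 0 < R)
    (h : EuclideanSpace ℝ (Fin n) → ℝ≥0∞) :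
    ∫⁻ y in ball x.ofLp R, h (WithLp.toLp 2 y) = ∫⁻ x in cubicInterval x R, h x := by
  rw [← toLp_preimage_cubicInterval x hR, setLIntegral_toLp_preimage]

theorem volume_cubicInterval_lt_top (x : EuclideanSpace ℝ (Fin n)) {R : ℝ} (hR : 0 < R) :
    volume (cubicInterval x R) < ⊤ := by
  have h := setLIntegral_ball_toLp x hR fun _ => 1
  rw [setLIntegral_one, setLIntegral_one] at h
  rw [← h]
  exact measure_ball_lt_top

theorem dist_ofLp_le_dist (x y : EuclideanSpace ℝ (Fin n)) : dist x.ofLp y.ofLp ≤ dist x y := by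
  simpa using (PiLp.lipschitzWith_ofLp 2 fun _ : Fin n => ℝ).dist_le_mul x y

/-- Every point of a cube has a boundary point of the cube at Euclidean distance equal to its
distance to the nearest face. -/
theorem exists_mem_frontier_dist_eq [NeZero n] {x₀ x : EuclideanSpace ℝ (Fin n)} {r : ℝ}
    (hr : 0 < r) (hx : x ∈ cubicInterval x₀ r) :
    ∃ y ∈ frontier (cubicInterval x₀ r), dist x y = r - dist x.ofLp x₀.ofLp := by
  -- The coordinate farthest from the centre is pushed out to its face; changing one coordinate
  -- makes Euclidean and sup distance agree.
  obtain ⟨i, hi⟩ := Finite.exists_max fun i => dist (x i) (x₀ i)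
  have hd : dist x.ofLp x₀.ofLp = dist (x i) (x₀ i) :=
    le_antisymm ((dist_pi_le_iff dist_nonneg).2 hi) (dist_le_pi_dist x.ofLp x₀.ofLp i)
  have hlt : |x i - x₀ i| < r := hx i
  rw [hd, Real.dist_eq]
  obtain ⟨a, ha, hai⟩ : ∃ a : ℝ, |a| = r - |x i - x₀ i| ∧ |x i + a - x₀ i| = r := by
    rcases le_total 0 (x i - x₀ i) with h | h
    · refine ⟨r - (x i - x₀ i), ?_, ?_⟩
      · rw [abs_of_nonneg h, abs_of_pos]
        rw [abs_of_nonneg h] at hlt; linarith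
      · rw [show x i + (r - (x i - x₀ i)) - x₀ i = r by ring, abs_of_pos hr]
    · refine ⟨-(r + (x i - x₀ i)), ?_, ?_⟩
      · rw [abs_neg, abs_of_nonpos h, abs_of_pos]
        · ring
        · rw [abs_of_nonpos h] at hlt; linarith
      · rw [show x i + -(r + (x i - x₀ i)) - x₀ i = -r by ring, abs_neg, abs_of_pos hr]
  refine ⟨x + EuclideanSpace.single i a, ?_, ?_⟩
  · rw [mem_frontier_cubicInterval_iff hr]
    refine le_antisymm ((dist_pi_le_iff hr.le).2 fun j => ?_) ?_
    · rcases eq_or_ne j i with rfl | hj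
      · simp [Real.dist_eq, hai]
      · simpa [hj, Real.dist_eq] using (hx j).le
    · have := dist_le_pi_dist (x + EuclideanSpace.single i a).ofLp x₀.ofLp i
      simpa [Real.dist_eq, hai] using this
  · rw [dist_self_add_right, PiLp.norm_single, Real.norm_eq_abs, ha]

theorem setDist_le_dist {A C : Set (EuclideanSpace ℝ (Fin n))} {x y : EuclideanSpace ℝ (Fin n)}
    (hx : x ∈ A) (hy : y ∈ C) : setDist A C ≤ dist x y :=
  csInf_le ⟨0, by rintro _ ⟨a, _, b, _, rfl⟩; exact dist_nonneg⟩ ⟨x, hx, y, hy, rfl⟩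

theorem setDist_frontier_cubicInterval_le [NeZero n] {x₀ x : EuclideanSpace ℝ (Fin n)} {r : ℝ}
    (hr : 0 < r) {A : Set (EuclideanSpace ℝ (Fin n))} (hA : A ⊆ cubicInterval x₀ r) (hx : x ∈ A) :
    setDist A (frontier (cubicInterval x₀ r)) ≤ r - dist x.ofLp x₀.ofLp := by
  obtain ⟨y, hy, hxy⟩ := exists_mem_frontier_dist_eq hr (hA hx)
  exact hxy ▸ setDist_le_dist hx hy

/-- A compact set and a disjoint closed set are a positive distance apart. Nonemptiness matters,
since `sInf ∅ = 0`. -/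
theorem setDist_frontier_pos [NeZero n] {x₀ : EuclideanSpace ℝ (Fin n)} {r : ℝ}
    (hr : 0 < r) {A : Set (EuclideanSpace ℝ (Fin n))}
    (hA : CompactlyContained A (cubicInterval x₀ r)) (hne : A.Nonempty) :
    0 < setDist A (frontier (cubicInterval x₀ r)) := by
  have hdisj : Disjoint (closure A) (frontier (cubicInterval x₀ r)) := by
    refine Set.disjoint_left.2 fun x hx hxf => ?_
    rw [(isOpen_cubicInterval x₀ hr).frontier_eq] at hxf
    exact hxf.2 (hA.2 hx)
  obtain ⟨ε, hε, h⟩ := Metric.exists_pos_forall_lt_edist hA.1 isClosed_frontier hdisj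
  obtain ⟨x, hx⟩ := hne
  obtain ⟨y, hy, -⟩ := exists_mem_frontier_dist_eq hr (hA.2 (subset_closure hx))
  refine lt_of_lt_of_le (NNReal.coe_pos.2 hε) (le_csInf ⟨_, x, hx, y, hy, rfl⟩ ?_)
  rintro _ ⟨a, ha, b, hb, rfl⟩
  have := (h a (subset_closure ha) b hb).le
  rw [edist_nndist, ENNReal.coe_le_coe] at this
  exact_mod_cast this

/-- Boundary points of the open set Ω lie outside Ω, hence outside the cube, so their distance from
z is at least that of z to the faces; and 4n exceeds √n. An empty boundary is covered, the distance
then being ∞. -/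
theorem ofReal_mul_sqrt_lt_infEDist_frontier {Ω : Set (EuclideanSpace ℝ (Fin n))} (hΩ : IsOpen Ω)
    (hn : 1 ≤ n) {x₀ z : EuclideanSpace ℝ (Fin n)} {r R : ℝ} (hr : 0 < r)
    (hQ : cubicInterval x₀ r ⊆ Ω) (hR : 0 < R) (hRz : 4 * n * R ≤ r - dist z.ofLp x₀.ofLp) :
    ENNReal.ofReal (R * √n) < infEDist z (frontier Ω) := by
  have hn' : (1 : ℝ) ≤ n := by exact_mod_cast hn
  have hs : √(n : ℝ) ≤ n := Real.sqrt_le_iff.2 ⟨by linarith, by nlinarith⟩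
  have hlt : R * √n < r - dist z.ofLp x₀.ofLp := by nlinarith
  have hd : 0 < r - dist z.ofLp x₀.ofLp := lt_of_le_of_lt (by positivity) hlt
  refine ((ofReal_lt_ofReal_iff hd).2 hlt).trans_le (le_infEDist.2 fun y hy => ?_)
  rw [hΩ.frontier_eq] at hy
  have hy' : ¬ dist y.ofLp x₀.ofLp < r := fun h => hy.2 (hQ ((mem_cubicInterval_iff hr).2 h))
  rw [edist_dist]
  refine ofReal_le_ofReal ?_
  have h1 := dist_triangle_left y.ofLp x₀.ofLp z.ofLp
  have h2 := dist_ofLp_le_dist z y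
  linarith

end EuclideanCubes

/-! ### Passage between L^s norms and lower Lebesgue integrals. -/

section LpBridge
open ENNReal

variable {α : Type*} [MeasurableSpace α] {μ : Measure α} {u : α → ℝ}

theorem lintegral_enorm_rpow_eq_of_nonneg (h0 : 0 ≤ᵐ[μ] u) (s : ℝ) :
    ∫⁻ x, ‖u x‖ₑ ^ s ∂μ = ∫⁻ x, ENNReal.ofReal (u x) ^ s ∂μ := by
  refine lintegral_congr_ae ?_
  filter_upwards [h0] with x hx
  rw [Real.enorm_of_nonneg hx]

theorem memLp_ofReal_iff_of_nonneg (hu : AEStronglyMeasurable u μ) (h0 : 0 ≤ᵐ[μ] u) {s : ℝ}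
    (hs : 0 < s) :
    MemLp u (ENNReal.ofReal s) μ ↔ ∫⁻ x, ENNReal.ofReal (u x) ^ s ∂μ ≠ ⊤ := by
  rw [← lintegral_enorm_rpow_eq_of_nonneg h0, MemLp, and_iff_right hu,
    eLpNorm_lt_top_iff_lintegral_rpow_enorm_lt_top (ofReal_pos.2 hs).ne' ofReal_ne_top,
    toReal_ofReal hs.le, lt_top_iff_ne_top]

theorem lpNorm_rpow_of_nonneg (hu : AEStronglyMeasurable u μ) (h0 : 0 ≤ᵐ[μ] u) {s : ℝ}
    (hs : 0 < s) :
    lpNorm u (ENNReal.ofReal s) μ ^ s = (∫⁻ x, ENNReal.ofReal (u x) ^ s ∂μ).toReal := by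
  rw [← toReal_eLpNorm hu, eLpNorm_eq_lintegral_rpow_enorm_toReal (ofReal_pos.2 hs).ne'
    ofReal_ne_top, toReal_ofReal hs.le, lintegral_enorm_rpow_eq_of_nonneg h0, toReal_rpow,
    ← rpow_mul, one_div_mul_cancel hs.ne', rpow_one]

theorem ofReal_integral_rpow_of_nonneg {s : ℝ} (hu : MemLp u (ENNReal.ofReal s) μ) (h0 : 0 ≤ᵐ[μ] u)
    (hs : 0 < s) :
    ENNReal.ofReal (∫ x, u x ^ s ∂μ) = ∫⁻ x, ENNReal.ofReal (u x) ^ s ∂μ := by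
  have hint : Integrable (fun x => u x ^ s) μ := by
    have h := hu.integrable_norm_rpow (ofReal_pos.2 hs).ne' ofReal_ne_top
    rw [toReal_ofReal hs.le] at h
    refine h.congr ?_
    filter_upwards [h0] with x hx
    rw [Real.norm_of_nonneg hx]
  rw [ofReal_integral_eq_lintegral_ofReal hint (by
    filter_upwards [h0] with x hx using Real.rpow_nonneg hx _)]
  refine lintegral_congr_ae ?_
  filter_upwards [h0] with x hx
  rw [ofReal_rpow_of_nonneg hx hs.le]

/-- A Borel representative of the positive part of `u`, extended by zero outside of `Q`. -/
theorem exists_measurable_representative {Q : Set α} (hQ : MeasurableSet Q)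
    (hu : AEStronglyMeasurable u (μ.restrict Q)) :
    ∃ F : α → ℝ≥0∞, Measurable F ∧ (∀ x ∉ Q, F x = 0) ∧ ∀ A ⊆ Q, ∀ s : ℝ,
      ∫⁻ x in A, F x ^ s ∂μ = ∫⁻ x in A, ENNReal.ofReal (u x) ^ s ∂μ := by
  refine ⟨Q.indicator fun x => ENNReal.ofReal (hu.mk u x),
    (hu.stronglyMeasurable_mk.measurable.ennreal_ofReal).indicator hQ,
    fun x hx => Set.indicator_of_notMem hx _, fun A hA s => ?_⟩
  refine lintegral_congr_ae (ae_restrict_of_ae_restrict_of_subset hA ?_)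
  filter_upwards [hu.ae_eq_mk, ae_restrict_mem hQ] with x hx hxQ
  rw [Set.indicator_of_mem hxQ, hx]

end LpBridge

/-! ### Transfer to Euclidean space and conclusion. -/

section Main
open ENNReal Filter Topology Metric

variable {n : ℕ}

/-- The reverse Hölder inequality on a cube inside of a larger cube, in terms of lower Lebesgue
integrals. -/
theorem ReverseHolder.lintegral_le {Ω : Set (EuclideanSpace ℝ (Fin n))} (hΩ : IsOpen Ω)
    {p α B R₀ : ℝ} {Φ Ψ : EuclideanSpace ℝ (Fin n) → ℝ} (hrev : ReverseHolder Ω p α B R₀ Φ Ψ)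
    (hn : 1 ≤ n) (hp : 1 < p) (hα : 1 / 2 ≤ α) (hα1 : α < 1) (hB : 0 < B)
    {x₀ : EuclideanSpace ℝ (Fin n)} {r : ℝ} (hr : 0 < r) (hrR : r < R₀)
    (hQ : cubicInterval x₀ r ⊆ Ω)
    (hΦ0 : ∀ᵐ x ∂(volume.restrict (cubicInterval x₀ r)), 0 ≤ Φ x)
    (hΨ0 : ∀ᵐ x ∂(volume.restrict (cubicInterval x₀ r)), 0 ≤ Ψ x)
    (hΦ : MemLpOn Φ p (cubicInterval x₀ r)) (hΨ : MemLpOn Ψ p (cubicInterval x₀ r))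
    {z : EuclideanSpace ℝ (Fin n)} (hz : z ∈ cubicInterval x₀ r) {R : ℝ} (hR : 0 < R)
    (hRz : 4 * n * R ≤ r - dist z.ofLp x₀.ofLp) :
    cubicInterval z R ⊆ cubicInterval x₀ r ∧
    ∫⁻ x in cubicInterval z (R / 2), ENNReal.ofReal (Φ x) ^ p ≤ ENNReal.ofReal R ^ n *
      (ENNReal.ofReal (B ^ (1 / p)) * ((ENNReal.ofReal R ^ n)⁻¹ *
        ∫⁻ x in cubicInterval z R, ENNReal.ofReal (Φ x))) ^ p
      + ∫⁻ x in cubicInterval z R, ENNReal.ofReal (Ψ x) ^ p := by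
  have hn' : (1 : ℝ) ≤ n := by exact_mod_cast hn
  have hp0 : 0 < p := by linarith
  have hRr : R ≤ r - dist z.ofLp x₀.ofLp := by nlinarith
  have hsub : cubicInterval z R ⊆ cubicInterval x₀ r := by
    intro y hy
    rw [mem_cubicInterval_iff hR] at hy
    rw [mem_cubicInterval_iff hr]
    linarith [dist_triangle y.ofLp z.ofLp x₀.ofLp]
  have hmono : ∀ {a c : ℝ}, a ≤ c → cubicInterval z a ⊆ cubicInterval z c :=
    fun hac y hy i => (hy i).trans_le hac
  have hαsub : cubicInterval z (α * R) ⊆ cubicInterval z R := hmono (by nlinarith)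
  refine ⟨hsub, ?_⟩
  have h := hrev z (hQ hz) R hR (by linarith [dist_nonneg (x := z.ofLp) (y := x₀.ofLp)])
    (ofReal_mul_sqrt_lt_infEDist_frontier hΩ hn hr hQ hR hRz)
  have hvol : IsFiniteMeasure (volume.restrict (cubicInterval z R)) :=
    ⟨by rw [Measure.restrict_apply_univ]; exact volume_cubicInterval_lt_top z hR⟩
  have hΦz : MemLp Φ (ENNReal.ofReal p) (volume.restrict (cubicInterval z R)) :=
    MemLp.mono_measure (Measure.restrict_mono hsub le_rfl) hΦ
  have hΨz : MemLp Ψ (ENNReal.ofReal p) (volume.restrict (cubicInterval z R)) :=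
    MemLp.mono_measure (Measure.restrict_mono hsub le_rfl) hΨ
  have hΦz0 := ae_restrict_of_ae_restrict_of_subset hsub hΦ0
  have hΨz0 := ae_restrict_of_ae_restrict_of_subset hsub hΨ0
  have e0 := ofReal_integral_rpow_of_nonneg
    (hΦz.mono_measure (Measure.restrict_mono hαsub le_rfl))
    (ae_restrict_of_ae_restrict_of_subset hαsub hΦz0) hp0
  have e1 := ofReal_integral_rpow_of_nonneg (s := 1) (hΦz.mono_exponent
    (ofReal_le_ofReal hp.le)) hΦz0 zero_lt_one
  have e2 := ofReal_integral_rpow_of_nonneg hΨz hΨz0 hp0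
  simp only [Real.rpow_one, rpow_one] at e1
  have hI1 : 0 ≤ ∫ x in cubicInterval z R, Φ x := integral_nonneg_of_ae hΦz0
  have hI2 : 0 ≤ ∫ x in cubicInterval z R, Ψ x ^ p := integral_nonneg_of_ae (by
    filter_upwards [hΨz0] with x hx using Real.rpow_nonneg hx _)
  have hRn : 0 < R ^ n := by positivity
  have hb : 0 ≤ B ^ (1 / p) := by positivity
  -- The normalisation R^{-n} is cleared and B enters the power as B^{1/p}, the form that combines
  -- with λ.
  have hreal : ∫ x in cubicInterval z (α * R), Φ x ^ p ≤
      R ^ n * (B ^ (1 / p) * ((R ^ n)⁻¹ * ∫ x in cubicInterval z R, Φ x)) ^ p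
        + ∫ x in cubicInterval z R, Ψ x ^ p := by
    rw [Real.mul_rpow hb (by positivity), ← Real.rpow_mul hB.le, one_div_mul_cancel hp0.ne',
      Real.rpow_one]
    have := mul_le_mul_of_nonneg_left h hRn.le
    rw [mul_add, one_div, mul_inv_cancel_left₀ hRn.ne', mul_inv_cancel_left₀ hRn.ne'] at this
    exact this
  calc ∫⁻ x in cubicInterval z (R / 2), ENNReal.ofReal (Φ x) ^ p
      ≤ ∫⁻ x in cubicInterval z (α * R), ENNReal.ofReal (Φ x) ^ p :=
        lintegral_mono_set (hmono (by nlinarith))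
    _ = ENNReal.ofReal (∫ x in cubicInterval z (α * R), Φ x ^ p) := e0.symm
    _ ≤ _ := ofReal_le_ofReal hreal
    _ = _ := by
        rw [ofReal_add (by positivity) hI2, ofReal_mul hRn.le, ofReal_pow hR.le,
          ← ofReal_rpow_of_nonneg (by positivity) hp0.le, ofReal_mul hb,
          ofReal_mul (by positivity), ofReal_inv_of_pos hRn, ofReal_pow hR.le, e1, e2]

/-- Quantitative higher integrability on a subset of a cube contained in `Ω`. -/
theorem higher_integrability_subset_cubicInterval (hn : 2 ≤ n)
    {Ω : Set (EuclideanSpace ℝ (Fin n))} (hΩ : IsOpen Ω)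
    {p q α B R₀ c : ℝ} {Φ Ψ : EuclideanSpace ℝ (Fin n) → ℝ}
    (hrev : ReverseHolder Ω p α B R₀ Φ Ψ) (hp : 1 < p) (hα : 1 / 2 ≤ α) (hα1 : α < 1)
    (hB : 0 < B) (hpq : p ≤ q) (hq : q < p + (p - 1) / (varkappa n p B - 1))
    {x₀ : EuclideanSpace ℝ (Fin n)} {r : ℝ} (hr : 0 < r) (hrR : r < R₀)
    (hQ : cubicInterval x₀ r ⊆ Ω)
    (hΦ0 : ∀ᵐ x ∂(volume.restrict (cubicInterval x₀ r)), 0 ≤ Φ x)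
    (hΨ0 : ∀ᵐ x ∂(volume.restrict (cubicInterval x₀ r)), 0 ≤ Ψ x)
    (hΦ : MemLpOn Φ p (cubicInterval x₀ r)) (hΨ : MemLpOn Ψ q (cubicInterval x₀ r))
    (hc : 0 < c) {A : Set (EuclideanSpace ℝ (Fin n))} (hA : MeasurableSet A)
    (hcA : ∀ x ∈ A, c ≤ r - dist x.ofLp x₀.ofLp) :
    ∫⁻ x in A, ENNReal.ofReal (Φ x) ^ q ≠ ⊤ ∧
    c ^ (n * q / p) * ((q - 1 - varkappa n p B * (q - p)) *
        (∫⁻ x in A, ENNReal.ofReal (Φ x) ^ q).toReal) ≤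
      (p - 1) * r ^ n *
          (∫⁻ x in cubicInterval x₀ r, ENNReal.ofReal (Φ x) ^ p).toReal ^ (q / p)
        + varkappa n p B * (q - 1) * r ^ (n * q / p) *
          (∫⁻ x in cubicInterval x₀ r, ENNReal.ofReal (Ψ x) ^ q).toReal := by
  have hp0 : 0 < p := by linarith
  have hvol : IsFiniteMeasure (volume.restrict (cubicInterval x₀ r)) :=
    ⟨by rw [Measure.restrict_apply_univ]; exact volume_cubicInterval_lt_top x₀ hr⟩
  have hΨp : MemLpOn Ψ p (cubicInterval x₀ r) :=
    MemLp.mono_exponent (q := ENNReal.ofReal q) hΨ (ofReal_le_ofReal hpq)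
  have hQm : MeasurableSet (cubicInterval x₀ r) := (isOpen_cubicInterval x₀ hr).measurableSet
  obtain ⟨F, hFm, hF0, hF⟩ := exists_measurable_representative hQm hΦ.aestronglyMeasurable
  obtain ⟨G, hGm, -, hG⟩ := exists_measurable_representative hQm hΨ.aestronglyMeasurable
  have hAsub : A ⊆ cubicInterval x₀ r := fun x hx => by
    rw [mem_cubicInterval_iff hr]; linarith [hcA x hx]
  have hto : Measurable (WithLp.toLp 2 : (Fin n → ℝ) → EuclideanSpace ℝ (Fin n)) :=
    (MeasurableEquiv.toLp 2 (Fin n → ℝ)).measurable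
  -- Extension by zero outside the cube makes the global integral of F^p the one over the cube.
  have hFall : ∫⁻ y, F (WithLp.toLp 2 y) ^ p =
      ∫⁻ x in cubicInterval x₀ r, ENNReal.ofReal (Φ x) ^ p := by
    rw [← hF _ subset_rfl, (PiLp.volume_preserving_toLp (Fin n)).lintegral_comp_emb
      (MeasurableEquiv.toLp 2 (Fin n → ℝ)).measurableEmbedding fun x => F x ^ p,
      setLIntegral_eq_of_support_subset]
    intro x hx
    by_contra h
    exact hx (by simp [hF0 x h, hp0])
  have key := higher_integrability_subset hn (F := fun y => F (WithLp.toLp 2 y))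
    (G := fun y => G (WithLp.toLp 2 y)) (q := q) (r := r) (B := B) (c := c) (x₀ := x₀.ofLp)
    (A := WithLp.toLp 2 ⁻¹' A) (hFm.comp hto) (hGm.comp hto) hp hB hpq hq (by
      intro z hz R hR hRz
      have hz' : WithLp.toLp 2 z ∈ cubicInterval x₀ r := (mem_cubicInterval_iff hr).2 hz
      obtain ⟨hsub, h⟩ := hrev.lintegral_le hΩ (by omega) hp hα hα1 hB hr hrR hQ hΦ0 hΨ0 hΦ hΨp
        hz' hR hRz
      have hsub2 : cubicInterval (WithLp.toLp 2 z) (R / 2) ⊆ cubicInterval x₀ r :=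
        fun y hy => hsub fun i => (hy i).trans_le (by linarith)
      have hF1 := hF _ hsub 1
      simp only [rpow_one] at hF1
      have i0 := setLIntegral_ball_toLp (WithLp.toLp 2 z) (half_pos hR) fun x => F x ^ p
      have i1 := setLIntegral_ball_toLp (WithLp.toLp 2 z) hR F
      have i2 := setLIntegral_ball_toLp (WithLp.toLp 2 z) hR fun x => G x ^ p
      rw [i0, i1, i2, hF _ hsub2, hF1, hG _ hsub]
      exact h)
    (by rw [hFall]; exact (memLp_ofReal_iff_of_nonneg hΦ.aestronglyMeasurable hΦ0 hp0).1 hΦ)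
    (by
      rw [setLIntegral_ball_toLp x₀ hr fun x => G x ^ q, hG _ subset_rfl]
      exact (memLp_ofReal_iff_of_nonneg hΨ.aestronglyMeasurable hΨ0 (by linarith)).1 hΨ)
    hr hc (hto hA) fun x hx => hcA _ hx
  rw [setLIntegral_toLp_preimage A fun x => F x ^ q, hF _ hAsub, hFall,
    setLIntegral_ball_toLp x₀ hr fun x => G x ^ q, hG _ subset_rfl] at key
  exact key

theorem exists_cubicInterval_subset {Ω : Set (EuclideanSpace ℝ (Fin n))} (hΩ : IsOpen Ω)
    {x : EuclideanSpace ℝ (Fin n)} (hx : x ∈ Ω) {R₀ : ℝ} (hR₀ : 0 < R₀) :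
    ∃ r, 0 < r ∧ r < R₀ ∧ cubicInterval x r ⊆ Ω := by
  set e := PiLp.homeomorph 2 (fun _ : Fin n => ℝ)
  have ho : IsOpen (e.symm ⁻¹' Ω) := hΩ.preimage e.symm.continuous
  obtain ⟨ε, hε, h⟩ := Metric.isOpen_iff.1 ho x.ofLp hx
  refine ⟨min ε R₀ / 2, by positivity, ?_, fun y hy => ?_⟩
  · linarith [min_le_right ε R₀]
  · rw [mem_cubicInterval_iff (by positivity)] at hy
    exact h (show y.ofLp ∈ ball x.ofLp ε from mem_ball.2 (by
      have := lt_min hε hR₀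
      linarith [min_le_left ε R₀]))

end Main

theorem proposition3p1 (n : ℕ) (hn : 2 ≤ n)
    (Ω : Set (EuclideanSpace ℝ (Fin n))) (hΩ : IsOpen Ω)
    (p δ α R₀ B : ℝ) (hp : 1 < p) (hδ : 0 < δ)
    (hα : 1 / 2 ≤ α) (hα1 : α < 1) (hR₀ : 0 < R₀) (hB : 0 < B)
    (Φ Ψ : EuclideanSpace ℝ (Fin n) → ℝ)
    (hΦ0 : ∀ᵐ x ∂(volume.restrict Ω), 0 ≤ Φ x)
    (hΨ0 : ∀ᵐ x ∂(volume.restrict Ω), 0 ≤ Ψ x)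
    (hΦ : MemLpOn Φ p Ω) (hΨ : MemLpOn Ψ (p + δ) Ω)
    (hrev : ReverseHolder Ω p α B R₀ Φ Ψ) :
    ∀ q : ℝ, p ≤ q → q ≤ p + δ → q < p + (p - 1) / (varkappa n p B - 1) →
      MemLpLocOn Φ q Ω ∧
      ∀ (x₀ : EuclideanSpace ℝ (Fin n)) (r : ℝ), 0 < r → r < R₀ →
        CompactlyContained (cubicInterval x₀ r) Ω →
        ∀ ω : Set (EuclideanSpace ℝ (Fin n)), MeasurableSet ω →
          CompactlyContained ω (cubicInterval x₀ r) →
          lpNormOn Φ q ω ^ q ≤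
            setDist ω (frontier (cubicInterval x₀ r)) ^ (-(n * q / p)) *
              (varkappa n p B * (q - 1) * r ^ (n * q / p)
                  / (q - 1 - varkappa n p B * (q - p))
                  * lpNormOn Ψ q (cubicInterval x₀ r) ^ q
                + (p - 1) * r ^ n / (q - 1 - varkappa n p B * (q - p))
                  * (lpNormOn Φ p (cubicInterval x₀ r) ^ p
                      + lpNormOn Ψ p (cubicInterval x₀ r) ^ p) ^ (q / p)) := by
  intro q hpq hqδ hq
  have hp0 : 0 < p := by linarith
  have hq0 : 0 < q := by linarith
  have : NeZero n := ⟨by omega⟩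
  have hκ := eight_mul_sq_add_one_le_varkappa (n := n) hp hB
  have hn' : (2 : ℝ) ≤ n := by exact_mod_cast hn
  have hk0 : 0 ≤ varkappa n p B := by nlinarith
  -- The bound on q says (ϰ-1)(q-p) < p-1, which rearranges to this.
  have hD : 0 < q - 1 - varkappa n p B * (q - p) := by
    have : (q - p) < (p - 1) / (varkappa n p B - 1) := by linarith
    rw [lt_div_iff₀ (by nlinarith)] at this
    linarith
  have hloc : ∀ {x₀ : EuclideanSpace ℝ (Fin n)} {r : ℝ}, 0 < r → cubicInterval x₀ r ⊆ Ω →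
      MemLpOn Φ p (cubicInterval x₀ r) ∧ MemLpOn Ψ q (cubicInterval x₀ r) := by
    intro x₀ r hr hQ
    have hvol : IsFiniteMeasure (volume.restrict (cubicInterval x₀ r)) :=
      ⟨by rw [Measure.restrict_apply_univ]; exact volume_cubicInterval_lt_top x₀ hr⟩
    have h : MemLp Ψ (ENNReal.ofReal (p + δ)) (volume.restrict (cubicInterval x₀ r)) :=
      MemLp.mono_measure (Measure.restrict_mono hQ le_rfl) hΨ
    exact ⟨MemLp.mono_measure (Measure.restrict_mono hQ le_rfl) hΦ,
      h.mono_exponent (ENNReal.ofReal_le_ofReal hqδ)⟩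
  have hmain := fun {x₀ : EuclideanSpace ℝ (Fin n)} {r c : ℝ} (hr : 0 < r) (hrR : r < R₀)
    (hQ : cubicInterval x₀ r ⊆ Ω) (hc : 0 < c) {A : Set (EuclideanSpace ℝ (Fin n))} =>
    higher_integrability_subset_cubicInterval hn hΩ hrev hp hα hα1 hB hpq hq hr hrR hQ
      (ae_restrict_of_ae_restrict_of_subset hQ hΦ0) (ae_restrict_of_ae_restrict_of_subset hQ hΨ0)
      (hloc hr hQ).1 (hloc hr hQ).2 hc (A := A)
  refine ⟨fun K hK hKΩ => ?_, fun x₀ r hr hrR hQΩ ω hω hωQ => ?_⟩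
  · have hKm : AEStronglyMeasurable Φ (volume.restrict K) :=
      hΦ.aestronglyMeasurable.mono_measure (Measure.restrict_mono hKΩ le_rfl)
    rw [MemLpOn, memLp_ofReal_iff_of_nonneg hKm (ae_restrict_of_ae_restrict_of_subset hKΩ hΦ0) hq0]
    -- Finiteness passes to subsets and finite unions, so by compactness it is enough to have it on
    -- a half-size cube around each point.
    refine (hK.induction_on (p := fun S => ∫⁻ x in S, ENNReal.ofReal (Φ x) ^ q < ⊤) (by simp)
      (fun S T hST hT => (lintegral_mono_set hST).trans_lt hT)
      (fun S T hS hT => (lintegral_union_le _ S T).trans_lt (ENNReal.add_lt_top.2 ⟨hS, hT⟩))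
      fun x hx => ?_).ne
    obtain ⟨r, hr, hrR, hQ⟩ := exists_cubicInterval_subset hΩ (hKΩ hx) hR₀
    have ho := isOpen_cubicInterval x (half_pos hr)
    refine ⟨cubicInterval x (r / 2), mem_nhdsWithin_of_mem_nhds (ho.mem_nhds ?_), ?_⟩
    · rw [mem_cubicInterval_iff (half_pos hr), dist_self]; exact half_pos hr
    · refine (hmain hr hrR hQ (half_pos hr) ho.measurableSet fun y hy => ?_).1.lt_top
      rw [mem_cubicInterval_iff (half_pos hr)] at hy
      linarith
  · have hQ : cubicInterval x₀ r ⊆ Ω := subset_closure.trans hQΩ.2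
    have hωQ' : ω ⊆ cubicInterval x₀ r := subset_closure.trans hωQ.2
    obtain ⟨hΦQ, hΨQ⟩ := hloc hr hQ
    have hΦQ0 := ae_restrict_of_ae_restrict_of_subset hQ hΦ0
    have hΨQ0 := ae_restrict_of_ae_restrict_of_subset hQ hΨ0
    have hp1 : 0 ≤ p - 1 := by linarith
    have hq1 : 0 ≤ q - 1 := by linarith
    have nn : ∀ (u : EuclideanSpace ℝ (Fin n) → ℝ) s A, 0 ≤ lpNormOn u s A ^ s :=
      fun u s A => Real.rpow_nonneg lpNorm_nonneg _
    have hrhs : 0 ≤ varkappa n p B * (q - 1) * r ^ (n * q / p)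
        / (q - 1 - varkappa n p B * (q - p)) * lpNormOn Ψ q (cubicInterval x₀ r) ^ q
        + (p - 1) * r ^ n / (q - 1 - varkappa n p B * (q - p))
          * (lpNormOn Φ p (cubicInterval x₀ r) ^ p
            + lpNormOn Ψ p (cubicInterval x₀ r) ^ p) ^ (q / p) := by
      have h1 := nn Ψ q (cubicInterval x₀ r)
      have h2 := add_nonneg (nn Φ p (cubicInterval x₀ r)) (nn Ψ p (cubicInterval x₀ r))
      positivity
    -- For empty ω the distance has the default value 0; the left side vanishes and the right side
    -- is nonnegative whatever the negative power of 0 means.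
    rcases ω.eq_empty_or_nonempty with rfl | hne
    · have h0 : lpNormOn Φ q ∅ ^ q = 0 := by
        simp [lpNormOn, Real.zero_rpow hq0.ne']
      rw [h0]
      refine mul_nonneg (Real.rpow_nonneg ?_ _) hrhs
      simp [setDist]
    have hc := setDist_frontier_pos hr hωQ hne
    have key := (hmain hr hrR hQ hc hω fun x hx =>
      setDist_frontier_cubicInterval_le hr hωQ' hx).2
    set c := setDist ω (frontier (cubicInterval x₀ r))
    rw [← lpNorm_rpow_of_nonneg
        (hΦQ.aestronglyMeasurable.mono_measure (Measure.restrict_mono hωQ' le_rfl))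
        (ae_restrict_of_ae_restrict_of_subset hωQ' hΦQ0) hq0,
      ← lpNorm_rpow_of_nonneg hΦQ.aestronglyMeasurable hΦQ0 hp0,
      ← lpNorm_rpow_of_nonneg hΨQ.aestronglyMeasurable hΨQ0 hq0] at key
    change c ^ (n * q / p) * ((q - 1 - varkappa n p B * (q - p)) * lpNormOn Φ q ω ^ q) ≤
      (p - 1) * r ^ n * (lpNormOn Φ p (cubicInterval x₀ r) ^ p) ^ (q / p) +
        varkappa n p B * (q - 1) * r ^ (n * q / p) * lpNormOn Ψ q (cubicInterval x₀ r) ^ q at key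
    have hcp : 0 < c ^ (n * q / p) := by positivity
    rw [Real.rpow_neg hc.le, inv_mul_eq_div, le_div_iff₀ hcp]
    -- The estimate obtained has no L^p norm of Ψ; adding it only weakens the bound to the stated
    -- form.
    have hT : (lpNormOn Φ p (cubicInterval x₀ r) ^ p) ^ (q / p) ≤
        (lpNormOn Φ p (cubicInterval x₀ r) ^ p + lpNormOn Ψ p (cubicInterval x₀ r) ^ p) ^ (q / p) :=
      Real.rpow_le_rpow (nn _ _ _) (le_add_of_nonneg_right (nn _ _ _)) (by positivity)
    refine le_of_mul_le_mul_left ?_ hD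
    calc (q - 1 - varkappa n p B * (q - p)) * (lpNormOn Φ q ω ^ q * c ^ (n * q / p))
        = c ^ (n * q / p) * ((q - 1 - varkappa n p B * (q - p)) * lpNormOn Φ q ω ^ q) := by ring
      _ ≤ _ := key
      _ ≤ (p - 1) * r ^ n * (lpNormOn Φ p (cubicInterval x₀ r) ^ p
            + lpNormOn Ψ p (cubicInterval x₀ r) ^ p) ^ (q / p) +
          varkappa n p B * (q - 1) * r ^ (n * q / p) * lpNormOn Ψ q (cubicInterval x₀ r) ^ q := by
        gcongr
      _ = _ := by field_simp; ring
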